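/- Consider the mixed packing-covering problem: given matrices $P\in[0,1]^{p\times n}$ and $C\in[0,1]^{c\times n}$, find $x\in[0,1]^n$ with $Px\le\mathbf 1$ and $Cx\ge\mathbf 1$, or report that there is none. Let $N$ be the total number of nonzero entries of $P$ and $C$, and let the width $w$ be the largest number of nonzero entries in a row of $P$ or of $C$. Assume that $N\ge 1$ and that $n,p,c\le N$ (which holds whenever each variable and each constraint has a nonzero coefficient). The machine is a parallel machine over the real numbers that acts on vectors: entrywise arithmetic operations, comparison, $\exp$ and $\log$, indirect reading, and indirect writing in which values written to the same address are added (or their maximum is taken). Its work is the total number of elementary operations and its parallel time is the length of the longest chain of dependent operations: entrywise operations and reading take one step, combining writes of $L$ values take $O(\log L)$ steps and $O(L\log L)$ work. There are one program for this machine and constants $K,k$ such that for all such $P,C$, given by the lists of their nonzero entries in arbitrary order, and all $0<\varepsilon\le 1$, the program halts after parallel time at most $$K\,\frac{w}{\varepsilon}\,\log^k\!\Big(2+\frac N\varepsilon\Big)$$ and total work at most $$K\,\frac{wN}{\varepsilon}\,\log^k\!\Big(2+\frac N\varepsilon\Big),$$ that is, in parallel time $\widetilde O(w/\varepsilon)$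 and with total work $\widetilde O(wN/\varepsilon)$, and it outputs either an $\varepsilon$-approximate solution, i.e. some $x\in[0,1]^n$ with $Px\le(1+\varepsilon)\mathbf 1$ and $Cx\ge(1-\varepsilon)\mathbf 1$, or the correct verdict that the problem has no solution, together with vectors $y\in\mathbb R^p$, $z\in\mathbb R^c$, $y,z\ge 0$, such that $y^T(P\bar x-\mathbf 1)+z^T(\mathbf 1-C\bar x)>0$ for all $\bar x\in[0,1]^n$. -/

import Mathlib

noncomputable section

namespace MPC

/-! ### Mixed packing-covering problems -/

/-- The number of nonzero entries of a matrix. -/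
def nnz {m n : ℕ} (A : Matrix (Fin m) (Fin n) ℝ) : ℕ :=
  {e : Fin m × Fin n | A e.1 e.2 ≠ 0}.ncard

/-- The largest number of nonzero entries in a row of a matrix. -/
def rowWidth {m n : ℕ} (A : Matrix (Fin m) (Fin n) ℝ) : ℕ :=
  Finset.univ.sup fun i : Fin m => {j : Fin n | A i j ≠ 0}.ncard

/-- The width of the program: the largest number of nonzeros in a packing or covering constraint. -/
def width {n p c : ℕ} (P : Matrix (Fin p) (Fin n) ℝ) (C : Matrix (Fin c) (Fin n) ℝ) : ℕ :=
  max (rowWidth P) (rowWidth C)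

/-- `x` is a solution of the problem: `0 ≤ x ≤ 1`, `P x ≤ 1` and `C x ≥ 1`. -/
def IsSolution {n p c : ℕ} (P : Matrix (Fin p) (Fin n) ℝ) (C : Matrix (Fin c) (Fin n) ℝ)
    (x : Fin n → ℝ) : Prop :=
  (∀ j, 0 ≤ x j ∧ x j ≤ 1) ∧ (∀ i, (P.mulVec x) i ≤ 1) ∧ (∀ i, 1 ≤ (C.mulVec x) i)

/-- `x` is an `ε`-approximate solution: `0 ≤ x ≤ 1`, `P x ≤ 1 + ε` and `C x ≥ 1 - ε`. -/
def IsApproxSolution {n p c : ℕ} (P : Matrix (Fin p) (Fin n) ℝ) (C : Matrix (Fin c) (Fin n) ℝ)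
    (ε : ℝ) (x : Fin n → ℝ) : Prop :=
  (∀ j, 0 ≤ x j ∧ x j ≤ 1) ∧ (∀ i, (P.mulVec x) i ≤ 1 + ε) ∧ (∀ i, 1 - ε ≤ (C.mulVec x) i)

/-- `(y, z)` are nonnegative multipliers, one per constraint, for which the weighted sum of the
constraint violations is positive at every point of the box. -/
def IsInfeasibilityCertificate {n p c : ℕ} (P : Matrix (Fin p) (Fin n) ℝ)
    (C : Matrix (Fin c) (Fin n) ℝ) (y : Fin p → ℝ) (z : Fin c → ℝ) : Prop :=
  (∀ i, 0 ≤ y i) ∧ (∀ i, 0 ≤ z i) ∧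
    ∀ x : Fin n → ℝ, (∀ j, 0 ≤ x j ∧ x j ≤ 1) →
      0 < (∑ i, y i * ((P.mulVec x) i - 1)) + ∑ i, z i * (1 - (C.mulVec x) i)

/-! ### A parallel machine: a vector random access machine over the reals

The machine has registers that hold vectors of real numbers and registers that hold vectors of
natural numbers (used as indices). An instruction acts on whole vectors, one processor per entry.
The work is the total number of elementary operations, the depth (parallel time) the length of the
longest chain of dependent operations. Instructions are executed one after the other, so depths
add up. -/

/-- The contents of the real registers and of the index registers. -/
structure State where
  real : ℕ → List ℝ
  index : ℕ → List ℕ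

/-- Overwrite one real register. -/
def State.setReal (s : State) (d : ℕ) (v : List ℝ) : State :=
  { s with real := Function.update s.real d v }

/-- Overwrite one index register. -/
def State.setIndex (s : State) (d : ℕ) (v : List ℕ) : State :=
  { s with index := Function.update s.index d v }

/-- Unary real operations. They are total, with the conventions of Mathlib (`log 0 = 0`). -/
inductive UnaryOp
  | exp
  | log

def UnaryOp.eval : UnaryOp → ℝ → ℝ
  | .exp, a => Real.exp a
  | .log, a => Real.log a

/-- Binary real operations; `lt` is the comparison with result `1` or `0`, and `a / 0 = 0`. -/
inductive BinaryOp
  | add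
  | sub
  | mul
  | div
  | min
  | max
  | lt

def BinaryOp.eval : BinaryOp → ℝ → ℝ → ℝ
  | .add, a, b => a + b
  | .sub, a, b => a - b
  | .mul, a, b => a * b
  | .div, a, b => a / b
  | .min, a, b => Min.min a b
  | .max, a, b => Max.max a b
  | .lt, a, b => if a < b then 1 else 0

/-- Binary operations on indices: addition and truncated subtraction. -/
inductive IndexOp
  | add
  | sub

def IndexOp.eval : IndexOp → ℕ → ℕ → ℕ
  | .add, a, b => a + b
  | .sub, a, b => a - b

/-- The associative and commutative operations by which values can be combined. -/
inductive CombineOp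
  | add
  | max

def CombineOp.eval : CombineOp → ℝ → ℝ → ℝ
  | .add, a, b => a + b
  | .max, a, b => Max.max a b

/-- Combine into the entry `base[j]`, for every `j`, all the `vals[t]` with `keys[t] = j`. -/
def combineByKey (op : CombineOp) (base : List ℝ) (keys : List ℕ) (vals : List ℝ) : List ℝ :=
  base.mapIdx fun j b =>
    (((keys.zip vals).filter fun kv => kv.1 = j).map Prod.snd).foldl op.eval b

/-- The instructions; `d` is always the destination register, and the remaining arguments that
are not operations or constants are source registers. -/
inductive Instr
  /-- the one-entry vector with a rational constant -/
  | realConst (d : ℕ) (q : ℚ)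
  /-- the one-entry vector with a natural constant -/
  | indexConst (d : ℕ) (k : ℕ)
  /-- entrywise unary operation -/
  | realMap (d : ℕ) (op : UnaryOp) (a : ℕ)
  /-- entrywise binary operation -/
  | realZip (d : ℕ) (op : BinaryOp) (a b : ℕ)
  /-- entrywise binary operation on indices -/
  | indexZip (d : ℕ) (op : IndexOp) (a b : ℕ)
  /-- entrywise conversion of indices into reals -/
  | toReal (d : ℕ) (a : ℕ)
  /-- the vector `0, 1, …, k - 1`, where `k` is the first entry of an index register -/
  | iota (d : ℕ) (a : ℕ)
  /-- the number of entries of an index register -/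
  | count (d : ℕ) (a : ℕ)
  /-- indirect reading of real entries -/
  | realGather (d : ℕ) (a i : ℕ)
  /-- indirect reading of index entries -/
  | indexGather (d : ℕ) (a i : ℕ)
  /-- indirect writing, where values with the same address are combined -/
  | combine (d : ℕ) (op : CombineOp) (base keys vals : ℕ)

/-- The effect of an instruction. -/
def Instr.run (s : State) : Instr → State
  | .realConst d q => s.setReal d [(q : ℝ)]
  | .indexConst d k => s.setIndex d [k]
  | .realMap d op a => s.setReal d ((s.real a).map op.eval)
  | .realZip d op a b => s.setReal d (List.zipWith op.eval (s.real a) (s.real b))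
  | .indexZip d op a b => s.setIndex d (List.zipWith op.eval (s.index a) (s.index b))
  | .toReal d a => s.setReal d ((s.index a).map fun k => (k : ℝ))
  | .iota d a => s.setIndex d (List.range ((s.index a).getD 0 0))
  | .count d a => s.setIndex d [(s.index a).length]
  | .realGather d a i => s.setReal d ((s.index i).map fun k => (s.real a).getD k 0)
  | .indexGather d a i => s.setIndex d ((s.index i).map fun k => (s.index a).getD k 0)
  | .combine d op b i v =>
      s.setReal d (combineByKey op (s.real b) (s.index i) (s.real v))

/-- The number of vector entries that an instruction handles. -/
def Instr.size (s : State) : Instr → ℕ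
  | .realConst _ _ => 1
  | .indexConst _ _ => 1
  | .realMap _ _ a => (s.real a).length
  | .realZip _ _ a b => (s.real a).length + (s.real b).length
  | .indexZip _ _ a b => (s.index a).length + (s.index b).length
  | .toReal _ a => (s.index a).length
  | .iota _ a => (s.index a).getD 0 0
  | .count _ _ => 1
  | .realGather _ _ i => (s.index i).length
  | .indexGather _ _ i => (s.index i).length
  | .combine _ _ b i v => (s.real b).length + (s.index i).length + (s.real v).length

/-- The parallel time of an instruction: constant for entrywise operations, and logarithmic in the
number of entries (sorting by key, then balanced trees) for `combine`. -/
def Instr.depth (s : State) : Instr → ℕ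
  | .combine d op b i v => 1 + Nat.clog 2 (1 + (Instr.combine d op b i v).size s)
  | _ => 1

/-- The work of an instruction: every entry is handled by a processor that is busy for the whole
parallel time of the instruction. -/
def Instr.work (s : State) (i : Instr) : ℕ := (1 + i.size s) * i.depth s

/-- Programs. A test asks whether the first entry of a real register is positive. -/
inductive Prog
  | instr (i : Instr)
  | seq (A B : Prog)
  | ite (a : ℕ) (A B : Prog)
  | loop (a : ℕ) (A : Prog)

/-- The outcome of the test of register `a` (an empty register counts as `0`). -/
def State.test (s : State) (a : ℕ) : Prop := 0 < (s.real a).getD 0 0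

/-- `Exec A s s' T W`: the program `A`, started in state `s`, halts in state `s'` after parallel
time `T` and with total work `W`. -/
inductive Exec : Prog → State → State → ℕ → ℕ → Prop
  | instr (i : Instr) (s : State) : Exec (.instr i) s (i.run s) (i.depth s) (i.work s)
  | seq {A B : Prog} {s s' s'' : State} {T W T' W' : ℕ} :
      Exec A s s' T W → Exec B s' s'' T' W' → Exec (.seq A B) s s'' (T + T') (W + W')
  | iteTrue {a : ℕ} {A B : Prog} {s s' : State} {T W : ℕ} :
      s.test a → Exec A s s' T W → Exec (.ite a A B) s s' (1 + T) (1 + W)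
  | iteFalse {a : ℕ} {A B : Prog} {s s' : State} {T W : ℕ} :
      ¬ s.test a → Exec B s s' T W → Exec (.ite a A B) s s' (1 + T) (1 + W)
  | loopTrue {a : ℕ} {A : Prog} {s s' s'' : State} {T W T' W' : ℕ} :
      s.test a → Exec A s s' T W → Exec (.loop a A) s' s'' T' W' →
        Exec (.loop a A) s s'' (1 + T + T') (1 + W + W')
  | loopFalse {a : ℕ} {A : Prog} {s : State} :
      ¬ s.test a → Exec (.loop a A) s s 1 1

/-! ### Input and output of the algorithm -/

/-- `l` lists the positions of the nonzero entries of `A`, each once, in some order. -/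
def Lists {m n : ℕ} (A : Matrix (Fin m) (Fin n) ℝ) (l : List (Fin m × Fin n)) : Prop :=
  l.Nodup ∧ ∀ e, e ∈ l ↔ A e.1 e.2 ≠ 0

/-- The initial state: the nonzero entries of `P` and `C` as lists of values, row indices and
column indices, the accuracy `ε`, and the dimensions. -/
def input {n p c : ℕ} (P : Matrix (Fin p) (Fin n) ℝ) (C : Matrix (Fin c) (Fin n) ℝ) (ε : ℝ)
    (lP : List (Fin p × Fin n)) (lC : List (Fin c × Fin n)) : State where
  real := fun r => match r with
    | 0 => lP.map fun e => P e.1 e.2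
    | 1 => lC.map fun e => C e.1 e.2
    | 2 => [ε]
    | _ => []
  index := fun r => match r with
    | 0 => lP.map fun e => (e.1 : ℕ)
    | 1 => lP.map fun e => (e.2 : ℕ)
    | 2 => lC.map fun e => (e.1 : ℕ)
    | 3 => lC.map fun e => (e.2 : ℕ)
    | 4 => [n]
    | 5 => [p]
    | 6 => [c]
    | _ => []

/-- The final state is correct: either register `0` holds the verdict `1` and register `1` an
`ε`-approximate solution, or register `0` holds the verdict `0`, the problem has no solution, and
registers `2` and `3` hold a certificate for this. -/
def CorrectOutput {n p c : ℕ} (P : Matrix (Fin p) (Fin n) ℝ) (C : Matrix (Fin c) (Fin n) ℝ)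
    (ε : ℝ) (s : State) : Prop :=
  (s.real 0 = [1] ∧ ∃ x : Fin n → ℝ, s.real 1 = List.ofFn x ∧ IsApproxSolution P C ε x) ∨
  (s.real 0 = [0] ∧ (¬ ∃ x : Fin n → ℝ, IsSolution P C x) ∧
    ∃ (y : Fin p → ℝ) (z : Fin c → ℝ), s.real 2 = List.ofFn y ∧ s.real 3 = List.ofFn z ∧
      IsInfeasibilityCertificate P C y z)

end MPC

end

namespace MPC

open Finset

/-! ### Real inequalities -/

/-! Stack the constraints as `A = [P; -C]`, `b = [1; -1]` and play the zero-sum game with payoff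
`yᵀ(Ax - b)`, where `x` lies in the box and `y` in the simplex over all constraints. Let `X`, `Y` be
the sums of `t` rounds of play. If the regret of these sums is at most `εt` against every pair, then
`X / t` decides the problem. Either all its violations are at most `ε`, or some row `i` is violated
by more. In the second case the regret bound with `y = eᵢ` forces `Yᵀ(Ax - b) > 0` for every `x` in
the box, so `Y` is the certificate (`sum_pos_of_violation`).

Low regret after about `w/ε` rounds comes from the regularizer `yᵀ|A|x² + 12w Σ yᵢ log yᵢ`. It is
bounded on the domain by `w` up to a logarithm. It need not be strongly convex, but it is area
convex: its convexity gap at the mean of three points dominates the area form of the game on them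
(`area_convexity`). The quadratic part `y x²` fails to be convex only by a multiple of `(√y' -
√y)²`. Relative entropy dominates this squared Hellinger distance, and row sums of at most `w` make
the factor `12w` sufficient. Area convexity is what an extragradient step needs, even with
approximate minimizers (`extragradient_step`).

Each step needs two minimizers of the regularizer plus a linear term. Alternating minimization is
explicit: coordinatewise clamping for `x`, exponential weights for `y`. One round halves the
relative entropy in a telescoping estimate (`objective_expWeights_sub_le`), so logarithmically many
rounds suffice.

The program runs this method. Its straight-line pieces never overwrite anything that they read or
wrote, so the final state satisfies the equations of all instructions at once (`holds_runAll`) and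
correctness becomes rewriting. Time and work are counted as a number of steps (`Attains`), each of
bounded cost while all vectors have at most `N` entries. -/

theorem sq_sqrt_sub_sqrt_le {a b : ℝ} (ha : 0 ≤ a) (hb : 0 ≤ b) (hab : b = 0 → a = 0) :
    (√a - √b) ^ 2 ≤ a * Real.log a - a * Real.log b - a + b := by
  rcases hb.eq_or_lt with rfl | hb
  · simp [hab rfl]
  rcases ha.eq_or_lt with rfl | ha
  · simp [Real.sq_sqrt hb.le]
  have h1 : 0 < √a := Real.sqrt_pos.2 ha
  have h2 : 0 < √b := Real.sqrt_pos.2 hb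
  -- Applying `log u ≤ u - 1` to the square root `u = √b / √a`, and multiplying by `2a`, leaves the
  -- squared Hellinger distance as the slack.
  have h3 := Real.log_le_sub_one_of_pos (div_pos h2 h1)
  rw [Real.log_div h2.ne' h1.ne', Real.log_sqrt hb.le, Real.log_sqrt ha.le] at h3
  have h4 : a * (√b / √a) = √a * √b := by
    rw [mul_div_assoc', div_eq_iff h1.ne']
    linear_combination (-√b) * Real.mul_self_sqrt ha.le
  have h5 := mul_le_mul_of_nonneg_left h3 ha.le
  rw [mul_sub, mul_sub, h4] at h5
  nlinarith [Real.sq_sqrt hb.le, Real.sq_sqrt ha.le]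

/-- The right-hand side is the Bregman divergence of `(x, y) ↦ y x²` from `(x, b²)` to `(x', a²)`.
The function is not convex, but the loss is only a multiple of `(a - b)²`, which the entropy will
pay for. -/
theorem quadratic_bregman_ge {a b x x' : ℝ} (hx : 0 ≤ x ∧ x ≤ 1) (hx' : 0 ≤ x' ∧ x' ≤ 1) :
    a ^ 2 * (x' - x) ^ 2 / 2 - 10 * (a - b) ^ 2 ≤
      a ^ 2 * (x' ^ 2 - x ^ 2) - 2 * b ^ 2 * x * (x' - x) ∧
    - (6 * (a - b) ^ 2) ≤ a ^ 2 * (x' ^ 2 - x ^ 2) - 2 * b ^ 2 * x * (x' - x) := by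
  obtain ⟨d, rfl⟩ : ∃ d, x' = x + d := ⟨x' - x, by ring⟩
  obtain ⟨e, rfl⟩ : ∃ e, b = a - e := ⟨a - b, by ring⟩
  have hd : |d| ≤ 1 := abs_le.2 ⟨by linarith, by linarith⟩
  have hxa : |x| ≤ 1 := abs_le.2 ⟨by linarith, by linarith⟩
  have hxd : |x * d| ≤ 1 := by rw [abs_mul]; exact mul_le_one₀ hxa (abs_nonneg _) hd
  have key : a ^ 2 * ((x + d) ^ 2 - x ^ 2) - 2 * (a - e) ^ 2 * x * (x + d - x) =
      (a * d) ^ 2 + 4 * (x * (a * d * e)) - 2 * (x * d) * e ^ 2 := by ring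
  have h1 : |x * (a * d * e)| ≤ |a * d| * |e| := by
    rw [abs_mul, abs_mul (a * d)]
    exact mul_le_of_le_one_left (by positivity) hxa
  have h2 : (x * d) * e ^ 2 ≤ e ^ 2 := by
    nlinarith [(abs_le.1 hxd).2, sq_nonneg e]
  have h3 := (abs_le.1 h1).1
  rw [key]
  have e1 : (a - (a - e)) = e := by ring
  rw [e1]
  constructor
  · nlinarith [sq_nonneg (|a * d| - 4 * |e|), sq_abs (a * d), sq_abs e]
  · nlinarith [sq_nonneg (|a * d| - 2 * |e|), sq_abs (a * d), sq_abs e]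

/-- The area of the triangle with corners `(x k, y k)`, up to sign and a factor two. -/
noncomputable def triangle (x y : Fin 3 → ℝ) : ℝ :=
  y 1 * x 0 - y 0 * x 1 + (y 2 * x 1 - y 1 * x 2) + (y 0 * x 2 - y 2 * x 0)

/-- Area convexity for a single matrix entry. The gap at the mean is a sum of three Bregman
divergences, since the linear terms cancel. The area is bilinear in the deviations from the mean, so
the quadratic gain and the Hellinger terms absorb it. -/
theorem triangle_le {x a : Fin 3 → ℝ} {x₀ b : ℝ} (hx : ∀ k, 0 ≤ x k ∧ x k ≤ 1)
    (hx₀ : x 0 + x 1 + x 2 = 3 * x₀)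
    (hab : a 0 ^ 2 + a 1 ^ 2 + a 2 ^ 2 = 3 * b ^ 2) :
    |triangle x fun k => a k ^ 2| / 12 ≤
      (∑ k, a k ^ 2 * x k ^ 2) - 3 * (b ^ 2 * x₀ ^ 2) + 12 * ∑ k, (a k - b) ^ 2 := by
  have h₀ : 0 ≤ x₀ ∧ x₀ ≤ 1 := by
    constructor <;> linarith [hx 0, hx 1, hx 2]
  have h1 : ∀ k, b ^ 2 * (x k - x₀) ^ 2 / 4 - 21 / 2 * (a k - b) ^ 2 ≤
      a k ^ 2 * (x k ^ 2 - x₀ ^ 2) - 2 * b ^ 2 * x₀ * (x k - x₀) := by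
    intro k
    have h := (quadratic_bregman_ge (a := a k) (b := b) h₀ (hx k)).1
    have hd : (x k - x₀) ^ 2 ≤ 1 := by
      have := hx k
      nlinarith
    have : b ^ 2 * (x k - x₀) ^ 2 ≤ 2 * (a k ^ 2 * (x k - x₀) ^ 2) + 2 * (a k - b) ^ 2 := by
      nlinarith [sq_nonneg ((2 * a k - b) * (x k - x₀)),
        mul_le_mul_of_nonneg_left hd (sq_nonneg (a k - b))]
    linarith
  have h2 : ∀ k l, |(x k - x₀) * (a l ^ 2 - b ^ 2)| ≤
      b ^ 2 * (x k - x₀) ^ 2 + 2 * (a l - b) ^ 2 := by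
    intro k l
    have hd : |x k - x₀| ≤ 1 := abs_le.2 ⟨by linarith [(hx k).1], by linarith [(hx k).2]⟩
    have e1 : (x k - x₀) * (a l ^ 2 - b ^ 2) =
        2 * ((b * (x k - x₀)) * (a l - b)) + (x k - x₀) * (a l - b) ^ 2 := by ring
    have e2 : |(x k - x₀) * (a l - b) ^ 2| ≤ (a l - b) ^ 2 := by
      rw [abs_mul, abs_of_nonneg (sq_nonneg (a l - b))]
      exact mul_le_of_le_one_left (sq_nonneg _) hd
    have e3 : |2 * ((b * (x k - x₀)) * (a l - b))| ≤ b ^ 2 * (x k - x₀) ^ 2 + (a l - b) ^ 2 := by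
      rw [abs_le]
      constructor <;> nlinarith [sq_nonneg (b * (x k - x₀) - (a l - b)),
        sq_nonneg (b * (x k - x₀) + (a l - b))]
    rw [e1]
    exact (abs_add_le _ _).trans (by linarith)
  -- Area is translation invariant and the deviations sum to zero, so the three determinants
  -- coincide.
  have h3 : (triangle x fun k => a k ^ 2) = 3 * ((x 0 - x₀) * (a 1 ^ 2 - b ^ 2)) -
      3 * ((x 1 - x₀) * (a 0 ^ 2 - b ^ 2)) := by
    have e1 : x 2 = 3 * x₀ - x 0 - x 1 := by linarith
    have e2 : a 2 ^ 2 = 3 * b ^ 2 - a 0 ^ 2 - a 1 ^ 2 := by linarith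
    simp only [triangle, e1, e2]
    ring
  have h4 : |triangle x fun k => a k ^ 2| ≤ 3 * (b ^ 2 * (x 0 - x₀) ^ 2 + 2 * (a 1 - b) ^ 2) +
      3 * (b ^ 2 * (x 1 - x₀) ^ 2 + 2 * (a 0 - b) ^ 2) := by
    rw [h3]
    refine (abs_sub _ _).trans ?_
    rw [abs_mul 3, abs_mul 3, abs_of_pos (zero_lt_three (α := ℝ))]
    have := h2 0 1
    have := h2 1 0
    linarith
  have e4 : (∑ k, a k ^ 2 * x k ^ 2) - 3 * (b ^ 2 * x₀ ^ 2) =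
      ∑ k, (a k ^ 2 * (x k ^ 2 - x₀ ^ 2) - 2 * b ^ 2 * x₀ * (x k - x₀)) := by
    simp only [Fin.sum_univ_three]
    linear_combination x₀ ^ 2 * hab + 2 * b ^ 2 * x₀ * hx₀
  rw [e4]
  simp only [Fin.sum_univ_three]
  have := h1 0
  have := h1 1
  have := h1 2
  have := mul_nonneg (sq_nonneg b) (sq_nonneg (x 2 - x₀))
  have := sq_nonneg (a 0 - b)
  have := sq_nonneg (a 1 - b)
  have := sq_nonneg (a 2 - b)
  linarith

/-! ### The box-simplex game -/

section Game

variable {I J : Type*} [Fintype I] [Fintype J]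

structure InDomain (x : J → ℝ) (y : I → ℝ) : Prop where
  box : ∀ j, 0 ≤ x j ∧ x j ≤ 1
  nonneg : ∀ i, 0 ≤ y i
  sum : ∑ i, y i = 1

/-- The regret of `t` rounds of play with sums `X` and `Y`, compared with the pair `(x, y)`. -/
noncomputable def regret (A : I → J → ℝ) (b : I → ℝ) (t : ℝ) (X : J → ℝ) (Y : I → ℝ)
    (x : J → ℝ) (y : I → ℝ) : ℝ :=
  ∑ i, y i * (∑ j, A i j * X j - t * b i) - ∑ i, Y i * (∑ j, A i j * x j - b i)

/-- The area-convex regularizer. -/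
noncomputable def regularizer (A : I → J → ℝ) (β : ℝ) (x : J → ℝ) (y : I → ℝ) : ℝ :=
  ∑ i, y i * ∑ j, |A i j| * x j ^ 2 + β * ∑ i, y i * Real.log (y i)

theorem regret_eq_sum (A : I → J → ℝ) (b : I → ℝ) (t : ℝ) (X : J → ℝ) (Y : I → ℝ) (x : J → ℝ)
    (y : I → ℝ) :
    regret A b t X Y x y =
      ∑ i, (∑ j, A i j * (y i * X j - Y i * x j) + b i * (Y i - t * y i)) := by
  rw [regret, ← sum_sub_distrib]
  refine sum_congr rfl fun i _ => ?_
  rw [mul_sub, mul_sub, mul_sum, mul_sum]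
  simp only [mul_sub, sum_sub_distrib]
  have e1 : ∑ j, y i * (A i j * X j) = ∑ j, A i j * (y i * X j) :=
    sum_congr rfl fun j _ => by ring
  have e2 : ∑ j, Y i * (A i j * x j) = ∑ j, A i j * (Y i * x j) :=
    sum_congr rfl fun j _ => by ring
  rw [e1, e2]
  ring

theorem regret_add (A : I → J → ℝ) (b : I → ℝ) (t t' r : ℝ) (X X' : J → ℝ) (Y Y' : I → ℝ)
    (x : J → ℝ) (y : I → ℝ) :
    regret A b (t + r * t') (fun j => X j + r * X' j) (fun i => Y i + r * Y' i) x y =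
      regret A b t X Y x y + r * regret A b t' X' Y' x y := by
  simp only [regret_eq_sum, mul_sum, ← sum_add_distrib]
  refine sum_congr rfl fun i _ => ?_
  have : ∑ j, A i j * (y i * (X j + r * X' j) - (Y i + r * Y' i) * x j) =
      ∑ j, A i j * (y i * X j - Y i * x j) + r * ∑ j, A i j * (y i * X' j - Y' i * x j) := by
    rw [mul_sum, ← sum_add_distrib]
    exact sum_congr rfl fun j _ => by ring
  rw [this]
  ring

theorem regret_skew (A : I → J → ℝ) (b : I → ℝ) (x x' : J → ℝ) (y y' : I → ℝ) :
    regret A b 1 x' y' x y = - regret A b 1 x y x' y' := by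
  simp [regret]

theorem regret_mean (A : I → J → ℝ) (b : I → ℝ) (t : ℝ) (X : J → ℝ) (Y : I → ℝ)
    {x : Fin 3 → J → ℝ} {y : Fin 3 → I → ℝ} {x₀ : J → ℝ} {y₀ : I → ℝ}
    (hx : ∀ j, x 0 j + x 1 j + x 2 j = 3 * x₀ j) (hy : ∀ i, y 0 i + y 1 i + y 2 i = 3 * y₀ i) :
    regret A b t X Y (x 0) (y 0) + regret A b t X Y (x 1) (y 1) + regret A b t X Y (x 2) (y 2) =
      3 * regret A b t X Y x₀ y₀ := by
  simp only [regret_eq_sum, mul_sum, ← sum_add_distrib]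
  refine sum_congr rfl fun i _ => ?_
  rw [mul_add, mul_sum]
  have : ∑ j, 3 * (A i j * (y₀ i * X j - Y i * x₀ j)) =
      ∑ j, A i j * (y 0 i * X j - Y i * x 0 j) + ∑ j, A i j * (y 1 i * X j - Y i * x 1 j) +
        ∑ j, A i j * (y 2 i * X j - Y i * x 2 j) := by
    rw [← sum_add_distrib, ← sum_add_distrib]
    exact sum_congr rfl fun j _ => by
      linear_combination - (A i j * X j) * hy i + A i j * Y i * hx j
  rw [this]
  linear_combination - b i * t * hy i

/-- It suffices to work row by row. `triangle_le` handles each entry with an error `12 |Aᵢⱼ|` times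
the Hellinger term `E`; these errors sum to at most `12 w E`, which the convexity gap of the entropy
covers. -/
theorem area_convexity {A : I → J → ℝ} {b : I → ℝ} {w : ℝ} (hA : ∀ i, ∑ j, |A i j| ≤ w)
    {x : Fin 3 → J → ℝ} {y : Fin 3 → I → ℝ} (hxy : ∀ k, InDomain (x k) (y k))
    {x₀ : J → ℝ} {y₀ : I → ℝ}
    (hx : ∀ j, x 0 j + x 1 j + x 2 j = 3 * x₀ j) (hy : ∀ i, y 0 i + y 1 i + y 2 i = 3 * y₀ i) :
    (regret A b 1 (x 0) (y 0) (x 1) (y 1) + regret A b 1 (x 1) (y 1) (x 2) (y 2) +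
      regret A b 1 (x 2) (y 2) (x 0) (y 0)) / 12 ≤
      (∑ k, regularizer A (12 * w) (x k) (y k)) - 3 * regularizer A (12 * w) x₀ y₀ := by
  -- The contributions of `b` cancel around the cycle.
  have e1 : (regret A b 1 (x 0) (y 0) (x 1) (y 1) + regret A b 1 (x 1) (y 1) (x 2) (y 2) +
      regret A b 1 (x 2) (y 2) (x 0) (y 0)) / 12 =
      ∑ i, ∑ j, A i j * (triangle (fun k => x k j) (fun k => y k i)) / 12 := by
    rw [div_eq_iff (by norm_num), sum_mul]
    simp only [regret_eq_sum, ← sum_add_distrib]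
    refine sum_congr rfl fun i _ => ?_
    have : (∑ j, A i j * triangle (fun k => x k j) (fun k => y k i) / 12) * 12 =
        ∑ j, A i j * (y 1 i * x 0 j - y 0 i * x 1 j) + ∑ j, A i j * (y 2 i * x 1 j - y 1 i * x 2 j)
          + ∑ j, A i j * (y 0 i * x 2 j - y 2 i * x 0 j) := by
      rw [sum_mul, ← sum_add_distrib, ← sum_add_distrib]
      exact sum_congr rfl fun j _ => by simp only [triangle]; ring
    rw [this]
    ring
  set gap : I → ℝ := fun i => (∑ k, y k i * Real.log (y k i)) - 3 * (y₀ i * Real.log (y₀ i))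
  have e2 : (∑ k, regularizer A (12 * w) (x k) (y k)) - 3 * regularizer A (12 * w) x₀ y₀ =
      ∑ i, (∑ j, |A i j| * ((∑ k, y k i * x k j ^ 2) - 3 * (y₀ i * x₀ j ^ 2)) +
        12 * w * gap i) := by
    simp only [regularizer, Fin.sum_univ_three, gap, mul_sum, sum_add_distrib, mul_sub, mul_add,
      sum_sub_distrib]
    have c1 : ∀ (s : ℝ) (x : J → ℝ) (y : I → ℝ), ∑ i, ∑ j, s * (y i * (|A i j| * x j ^ 2)) =
        ∑ i, ∑ j, |A i j| * (s * (y i * x j ^ 2)) := fun s x y =>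
      sum_congr rfl fun i _ => sum_congr rfl fun j _ => by ring
    have c2 : ∀ (x : J → ℝ) (y : I → ℝ), ∑ i, ∑ j, (y i * (|A i j| * x j ^ 2)) =
        ∑ i, ∑ j, |A i j| * ((y i * x j ^ 2)) := fun x y =>
      sum_congr rfl fun i _ => sum_congr rfl fun j _ => by ring
    have c3 : ∀ y : I → ℝ, ∑ i, 3 * (12 * w * (y i * Real.log (y i))) =
        ∑ i, 12 * w * (3 * (y i * Real.log (y i))) := fun y => sum_congr rfl fun i _ => by ring
    simp only [c1, c2, c3]
    ring
  rw [e1, e2]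
  refine sum_le_sum fun i _ => ?_
  have hy₀ : 0 ≤ y₀ i := by
    linarith [hy i, (hxy 0).nonneg i, (hxy 1).nonneg i, (hxy 2).nonneg i]
  set E := ∑ k, (√(y k i) - √(y₀ i)) ^ 2
  have hE : 0 ≤ E := sum_nonneg fun k _ => sq_nonneg _
  have hgap : E ≤ gap i := by
    have hz : ∀ k, y₀ i = 0 → y k i = 0 := by
      intro k h
      have h0 := (hxy 0).nonneg i
      have h1 := (hxy 1).nonneg i
      have h2 := (hxy 2).nonneg i
      have := hy i
      fin_cases k <;> simp <;> linarith
    have h := fun k => sq_sqrt_sub_sqrt_le ((hxy k).nonneg i) hy₀ (hz k)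
    have h' := sum_le_sum fun k (_ : k ∈ univ) => h k
    refine h'.trans (le_of_eq ?_)
    simp only [gap, Fin.sum_univ_three]
    linear_combination (- Real.log (y₀ i) - 1) * hy i
  have hterm : ∀ j, A i j * triangle (fun k => x k j) (fun k => y k i) / 12 ≤
      |A i j| * ((∑ k, y k i * x k j ^ 2) - 3 * (y₀ i * x₀ j ^ 2)) + |A i j| * (12 * E) := by
    intro j
    have h := triangle_le (x := fun k => x k j) (a := fun k => √(y k i)) (x₀ := x₀ j)
      (b := √(y₀ i)) (fun k => (hxy k).box j) 
      (hx j) (by simp only [Real.sq_sqrt ((hxy _).nonneg i), Real.sq_sqrt hy₀, hy i])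
    simp only [Real.sq_sqrt ((hxy _).nonneg i), Real.sq_sqrt hy₀] at h
    rw [← mul_add, mul_div_assoc]
    refine (le_abs_self _).trans ?_
    rw [abs_mul, abs_div, abs_of_pos (show (0 : ℝ) < 12 by norm_num)]
    exact mul_le_mul_of_nonneg_left h (abs_nonneg _)
  refine (sum_le_sum fun j _ => hterm j).trans ?_
  rw [sum_add_distrib, ← sum_mul]
  have hw : 0 ≤ w := (sum_nonneg fun j _ => abs_nonneg (A i j)).trans (hA i)
  have h1 : (∑ j, |A i j|) * (12 * E) ≤ w * (12 * E) :=
    mul_le_mul_of_nonneg_right (hA i) (by positivity)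
  have h2 : w * E ≤ w * gap i := mul_le_mul_of_nonneg_left hgap hw
  linarith

/-- One round of the extragradient method with approximate minimizers. -/
theorem extragradient_step {A : I → J → ℝ} {b : I → ℝ} {w δ t : ℝ} (hA : ∀ i, ∑ j, |A i j| ≤ w)
    {X xp xq x : J → ℝ} {Y yp yq y : I → ℝ}
    (hp : InDomain xp yp) (hq : InDomain xq yq) (hu : InDomain x y)
    (hpmin : ∀ x y, InDomain x y →
      regularizer A (12 * w) xp yp - regret A b t X Y xp yp / 24 ≤
        regularizer A (12 * w) x y - regret A b t X Y x y / 24 + δ)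
    (hqmin : ∀ x y, InDomain x y →
      regularizer A (12 * w) xq yq - regret A b (t + 2) (fun j => X j + 2 * xp j)
        (fun i => Y i + 2 * yp i) xq yq / 24 ≤
      regularizer A (12 * w) x y - regret A b (t + 2) (fun j => X j + 2 * xp j)
        (fun i => Y i + 2 * yp i) x y / 24 + δ) :
    regularizer A (12 * w) xp yp - regret A b t X Y xp yp / 24 - 2 * δ ≤
      regularizer A (12 * w) x y - regret A b (t + 1) (fun j => X j + xq j)
        (fun i => Y i + yq i) x y / 24 := by
  have r1 : ∀ x y, regret A b (t + 2) (fun j => X j + 2 * xp j) (fun i => Y i + 2 * yp i) x y =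
      regret A b t X Y x y + 2 * regret A b 1 xp yp x y := fun x y => by
    simpa using regret_add A b t 1 2 X xp Y yp x y
  have r2 : regret A b (t + 1) (fun j => X j + xq j) (fun i => Y i + yq i) x y =
      regret A b t X Y x y + regret A b 1 xq yq x y := by
    simpa using regret_add A b t 1 1 X xq Y yq x y
  simp only [r1] at hqmin
  rw [r2]
  set x₀ : J → ℝ := fun j => (xp j + xq j + x j) / 3
  set y₀ : I → ℝ := fun i => (yp i + yq i + y i) / 3
  have hx₀ : ∀ j, ![xp, xq, x] 0 j + ![xp, xq, x] 1 j + ![xp, xq, x] 2 j = 3 * x₀ j := by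
    intro j; simp [x₀]; ring
  have hy₀ : ∀ j, ![yp, yq, y] 0 j + ![yp, yq, y] 1 j + ![yp, yq, y] 2 j = 3 * y₀ j := by
    intro j; simp [y₀]; ring
  have h₀ : InDomain x₀ y₀ := by
    refine ⟨fun j => ?_, fun i => ?_, ?_⟩
    · have := hp.box j; have := hq.box j; have := hu.box j
      simp only [x₀]
      constructor <;> linarith
    · have := hp.nonneg i; have := hq.nonneg i; have := hu.nonneg i
      simp only [y₀]
      linarith
    · simp only [y₀]
      rw [← sum_div, sum_add_distrib, sum_add_distrib, hp.sum, hq.sum, hu.sum]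
      norm_num
  have hdom : ∀ k, InDomain (![xp, xq, x] k) (![yp, yq, y] k) := by
    intro k; fin_cases k <;> simpa
  have harea := area_convexity (b := b) hA hdom hx₀ hy₀
  have hmean := regret_mean A b t X Y hx₀ hy₀
  simp only [Fin.sum_univ_three, Matrix.cons_val_zero, Matrix.cons_val_one, Matrix.cons_val]
    at harea hmean
  have h1 := hpmin x₀ y₀ h₀
  have h2 := hqmin x y hu
  rw [regret_skew A b xp x yp y] at harea
  -- Three times `h1`, once `h2` and `harea` sum to twice the claim. Extrapolating by `2` with the
  -- scale `1/24` produces the factor `1/12` of area convexity, so the terms pairing `p` with `q`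
  -- and with `u` cancel.
  linarith

end Game

/-! ### Alternating minimization for the regularized reply -/

section Alternating

variable {I J : Type*} [Fintype I] [Fintype J]

noncomputable def relEntropy (y' y : I → ℝ) : ℝ := ∑ i, y' i * (Real.log (y' i) - Real.log (y i))

theorem sum_sq_sqrt_le_relEntropy {y' y : I → ℝ} (hy' : ∀ i, 0 ≤ y' i) (hy : ∀ i, 0 < y i)
    (h : ∑ i, y' i = ∑ i, y i) : ∑ i, (√(y' i) - √(y i)) ^ 2 ≤ relEntropy y' y := by
  have h1 := sum_le_sum fun i (_ : i ∈ univ) =>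
    sq_sqrt_sub_sqrt_le (hy' i) (hy i).le fun h => absurd h (hy i).ne'
  refine h1.trans (le_of_eq ?_)
  rw [sum_add_distrib, sum_sub_distrib, h, sub_add_cancel]
  exact sum_congr rfl fun i _ => (mul_sub _ _ _).symm

theorem relEntropy_nonneg {y' y : I → ℝ} (hy' : ∀ i, 0 ≤ y' i) (hy : ∀ i, 0 < y i)
    (h : ∑ i, y' i = ∑ i, y i) : 0 ≤ relEntropy y' y :=
  (sum_nonneg fun _ _ => sq_nonneg _).trans (sum_sq_sqrt_le_relEntropy hy' hy h)

noncomputable def expWeights (v : I → ℝ) (i : I) : ℝ := Real.exp (v i) / ∑ k, Real.exp (v k)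

theorem sum_exp_pos [Nonempty I] (v : I → ℝ) : 0 < ∑ k, Real.exp (v k) :=
  sum_pos (fun _ _ => Real.exp_pos _) univ_nonempty

theorem expWeights_pos [Nonempty I] (v : I → ℝ) (i : I) : 0 < expWeights v i :=
  div_pos (Real.exp_pos _) (sum_exp_pos v)

theorem sum_expWeights [Nonempty I] (v : I → ℝ) : ∑ i, expWeights v i = 1 := by
  simp only [expWeights]
  rw [← sum_div, div_self (sum_exp_pos v).ne']

theorem log_expWeights [Nonempty I] (v : I → ℝ) (i : I) :
    Real.log (expWeights v i) = v i - Real.log (∑ k, Real.exp (v k)) := by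
  rw [expWeights, Real.log_div (Real.exp_pos _).ne' (sum_exp_pos v).ne', Real.log_exp]

/-- Gibbs' variational principle: the exponential weights are the minimizer, and the excess of any
other distribution is its relative entropy to them. -/
theorem sum_log_sub_eq [Nonempty I] (v : I → ℝ) {y : I → ℝ} (hy : ∑ i, y i = 1) :
    ∑ i, y i * (Real.log (y i) - v i) =
      ∑ i, expWeights v i * (Real.log (expWeights v i) - v i) + relEntropy y (expWeights v) := by
  have h : ∀ i, expWeights v i * (Real.log (expWeights v i) - v i) =
      - Real.log (∑ k, Real.exp (v k)) * expWeights v i := fun i => by rw [log_expWeights]; ring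
  rw [sum_congr rfl fun i _ => h i, ← mul_sum, sum_expWeights]
  simp only [relEntropy, log_expWeights]
  have h2 : ∀ i, y i * (Real.log (y i) - (v i - Real.log (∑ k, Real.exp (v k)))) =
      y i * (Real.log (y i) - v i) + Real.log (∑ k, Real.exp (v k)) * y i := fun i => by ring
  simp only [h2, sum_add_distrib, ← mul_sum, hy]
  ring

/-- The regularizer with a linear term. -/
noncomputable def objective (A : I → J → ℝ) (β : ℝ) (g : J → ℝ) (h : I → ℝ) (x : J → ℝ)
    (y : I → ℝ) : ℝ :=
  regularizer A β x y - ∑ j, g j * x j - ∑ i, h i * y i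

/-- The regret is affine in the pair that it is compared with, so computing a reply means minimizing
the regularizer plus a linear term; the constant does not matter. -/
theorem regularizer_sub_regret (A : I → J → ℝ) (β : ℝ) (b : I → ℝ) (t : ℝ) (X : J → ℝ)
    (Y : I → ℝ) (x : J → ℝ) (y : I → ℝ) :
    regularizer A β x y - regret A b t X Y x y / 24 =
      objective A β (fun j => -(∑ i, A i j * Y i) / 24)
        (fun i => (∑ j, A i j * X j - t * b i) / 24) x y - (∑ i, Y i * b i) / 24 := by
  have h1 : ∑ j, -(∑ i, A i j * Y i) / 24 * x j = - (∑ i, Y i * ∑ j, A i j * x j) / 24 := by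
    simp only [neg_div, neg_mul, sum_neg_distrib, neg_inj, div_mul_eq_mul_div, ← sum_div, sum_mul,
      mul_sum]
    rw [sum_comm]
    congr 1
    exact sum_congr rfl fun i _ => sum_congr rfl fun j _ => by ring
  have h2 : ∑ i, (∑ j, A i j * X j - t * b i) / 24 * y i =
      (∑ i, y i * (∑ j, A i j * X j - t * b i)) / 24 := by
    rw [sum_div]
    exact sum_congr rfl fun i _ => by ring
  rw [objective, h1, h2, regret]
  simp only [mul_sub, sum_sub_distrib]
  ring

/-- The exponents of the optimal weights for a given point of the box. -/
noncomputable def exponent (A : I → J → ℝ) (β : ℝ) (h : I → ℝ) (x : J → ℝ) (i : I) : ℝ :=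
  (h i - ∑ j, |A i j| * x j ^ 2) / β

theorem objective_eq_add_relEntropy [Nonempty I] (A : I → J → ℝ) {β : ℝ} (hβ : β ≠ 0) (g : J → ℝ)
    (h : I → ℝ) (x : J → ℝ) {y : I → ℝ} (hy : ∑ i, y i = 1) :
    objective A β g h x y = objective A β g h x (expWeights (exponent A β h x)) +
      β * relEntropy y (expWeights (exponent A β h x)) := by
  have key : ∀ y : I → ℝ, objective A β g h x y =
      β * ∑ i, y i * (Real.log (y i) - exponent A β h x i) - ∑ j, g j * x j := by
    intro y
    simp only [objective, regularizer, exponent]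
    have : β * ∑ i, y i * (Real.log (y i) - (h i - ∑ j, |A i j| * x j ^ 2) / β) =
        ∑ i, (y i * ∑ j, |A i j| * x j ^ 2) + β * ∑ i, y i * Real.log (y i) - ∑ i, h i * y i := by
      simp only [mul_sum (s := univ) (a := β), ← sum_add_distrib, ← sum_sub_distrib]
      refine sum_congr rfl fun i _ => ?_
      field_simp
      ring
    rw [this]
    ring
  rw [key y, key, sum_log_sub_eq _ hy]
  ring

/-- `x` minimizes the objective over the box when the weights are `y`. -/
def IsBoxMin (A : I → J → ℝ) (g : J → ℝ) (y : I → ℝ) (x : J → ℝ) : Prop :=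
  ∀ j, (0 ≤ x j ∧ x j ≤ 1) ∧
    ∀ s, 0 ≤ s → s ≤ 1 → g j * (s - x j) ≤ 2 * (∑ i, |A i j| * y i) * x j * (s - x j)

theorem sum_mul_le_of_isBoxMin {A : I → J → ℝ} {g : J → ℝ} {y : I → ℝ} {x x' : J → ℝ}
    (hx : IsBoxMin A g y x) (hx' : ∀ j, 0 ≤ x' j ∧ x' j ≤ 1) :
    ∑ j, g j * x' j - ∑ j, g j * x j ≤
      ∑ i, ∑ j, |A i j| * (2 * y i * x j * (x' j - x j)) := by
  rw [← sum_sub_distrib, sum_comm]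
  refine sum_le_sum fun j _ => ?_
  have h := (hx j).2 (x' j) (hx' j).1 (hx' j).2
  rw [← mul_sub]
  refine h.trans (le_of_eq ?_)
  rw [mul_sum, sum_mul, sum_mul]
  exact sum_congr rfl fun i _ => by ring

theorem regularizer_sub_regularizer (A : I → J → ℝ) (β : ℝ) (x x' : J → ℝ) (y : I → ℝ) :
    regularizer A β x' y - regularizer A β x y =
      ∑ i, ∑ j, |A i j| * (y i * (x' j ^ 2 - x j ^ 2)) := by
  rw [regularizer, regularizer, add_sub_add_right_eq_sub, ← sum_sub_distrib]
  refine sum_congr rfl fun i _ => ?_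
  rw [← mul_sub, ← sum_sub_distrib, mul_sum]
  exact sum_congr rfl fun j _ => by ring

theorem objective_boxMin_le {A : I → J → ℝ} {β : ℝ} {g : J → ℝ} {h : I → ℝ} {y : I → ℝ}
    {x x' : J → ℝ} (hy : ∀ i, 0 ≤ y i) (hx : IsBoxMin A g y x) (hx' : ∀ j, 0 ≤ x' j ∧ x' j ≤ 1) :
    objective A β g h x y ≤ objective A β g h x' y := by
  have h1 := sum_mul_le_of_isBoxMin hx hx'
  have h2 := regularizer_sub_regularizer A β x x' y
  have h3 : ∑ i, ∑ j, |A i j| * (2 * y i * x j * (x' j - x j)) ≤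
      ∑ i, ∑ j, |A i j| * (y i * (x' j ^ 2 - x j ^ 2)) := by
    refine sum_le_sum fun i _ => sum_le_sum fun j _ =>
      mul_le_mul_of_nonneg_left ?_ (abs_nonneg _)
    nlinarith [mul_nonneg (hy i) (sq_nonneg (x' j - x j))]
  simp only [objective]
  linarith

/-- Moving from `(x', y')` to `(x, y')` costs at most the negative part of a Bregman divergence
based at `(x, y)`, because `x` is optimal for `y`; hence `6w` times `relEntropy y' y`. Optimizing
the weights then gains exactly `12w` times the new relative entropy. The ratio of the two
coefficients is the contraction factor `1/2`. -/
theorem objective_expWeights_sub_le [Nonempty I] {A : I → J → ℝ} {w : ℝ} (hw : 0 < w)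
    (hA : ∀ i, ∑ j, |A i j| ≤ w) {g : J → ℝ} {h : I → ℝ} {x x' : J → ℝ} {y y' : I → ℝ}
    (hy : ∀ i, 0 < y i) (hys : ∑ i, y i = 1) (hx : IsBoxMin A g y x) (hu : InDomain x' y') :
    objective A (12 * w) g h x (expWeights (exponent A (12 * w) h x)) -
        objective A (12 * w) g h x' y' ≤
      6 * w * relEntropy y' y -
        12 * w * relEntropy y' (expWeights (exponent A (12 * w) h x)) := by
  have h1 := objective_eq_add_relEntropy A (β := 12 * w) (by positivity) g h x hu.sum
  have h2 := sum_mul_le_of_isBoxMin hx hu.box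
  have h3 := regularizer_sub_regularizer A (12 * w) x x' y'
  have h4 : ∑ i, ∑ j, |A i j| * (2 * y i * x j * (x' j - x j)) -
      ∑ i, ∑ j, |A i j| * (y' i * (x' j ^ 2 - x j ^ 2)) ≤ 6 * w * relEntropy y' y := by
    rw [← sum_sub_distrib]
    have h5 := sum_sq_sqrt_le_relEntropy hu.nonneg hy (hu.sum.trans hys.symm)
    refine le_trans ?_ (mul_le_mul_of_nonneg_left h5 (by positivity))
    rw [mul_sum]
    refine sum_le_sum fun i _ => ?_
    rw [← sum_sub_distrib]
    have h6 : ∀ j, |A i j| * (2 * y i * x j * (x' j - x j)) -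
        |A i j| * (y' i * (x' j ^ 2 - x j ^ 2)) ≤
        |A i j| * (6 * (√(y' i) - √(y i)) ^ 2) := by
      intro j
      rw [← mul_sub]
      refine mul_le_mul_of_nonneg_left ?_ (abs_nonneg _)
      have := (quadratic_bregman_ge (a := √(y' i)) (b := √(y i)) (hx j).1 (hu.box j)).2
      rw [Real.sq_sqrt (hu.nonneg i), Real.sq_sqrt (hy i).le] at this
      linarith
    refine (sum_le_sum fun j _ => h6 j).trans ?_
    rw [← sum_mul]
    have := mul_le_mul_of_nonneg_right (hA i)
      (show 0 ≤ 6 * (√(y' i) - √(y i)) ^ 2 by positivity)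
    linarith
  simp only [objective] at h1 ⊢
  linarith

/-- The state of the alternating minimization after `k` rounds. -/
structure AlternatingInv (A : I → J → ℝ) (w : ℝ) (g : J → ℝ) (h : I → ℝ) (y₀ : I → ℝ) (k : ℕ)
    (x : J → ℝ) (y : I → ℝ) : Prop where
  box : ∀ j, 0 ≤ x j ∧ x j ≤ 1
  pos : ∀ i, 0 < y i
  sum : ∑ i, y i = 1
  bound : ∀ x' y', InDomain x' y' →
    (2 ^ k - 1) * (objective A (12 * w) g h x y - objective A (12 * w) g h x' y') +
      6 * w * 2 ^ k * relEntropy y' y ≤ 6 * w * relEntropy y' y₀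

/-- Multiply the one-round estimate by `2 ^ k` and add `2 ^ k - 1` times the monotonicity of the
objective. The coefficients become those for `k + 1`. -/
theorem AlternatingInv.step [Nonempty I] {A : I → J → ℝ} {w : ℝ} (hw : 0 < w)
    (hA : ∀ i, ∑ j, |A i j| ≤ w) {g : J → ℝ} {h : I → ℝ} {y₀ : I → ℝ} {k : ℕ} {x x' : J → ℝ}
    {y : I → ℝ} (H : AlternatingInv A w g h y₀ k x y) (hx' : IsBoxMin A g y x') :
    AlternatingInv A w g h y₀ (k + 1) x' (expWeights (exponent A (12 * w) h x')) where
  box j := (hx' j).1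
  pos := expWeights_pos _
  sum := sum_expWeights _
  bound xu yu hu := by
    have h1 := objective_expWeights_sub_le hw hA (h := h) H.pos H.sum hx' hu
    have h2 := objective_boxMin_le (β := 12 * w) (h := h) (fun i => (H.pos i).le) hx' H.box
    have h3 := objective_eq_add_relEntropy A (β := 12 * w) (by positivity) g h x' H.sum
    have h4 := relEntropy_nonneg (fun i => (H.pos i).le)
      (expWeights_pos (exponent A (12 * w) h x')) (H.sum.trans (sum_expWeights _).symm)
    have h5 := H.bound xu yu hu
    set Ψ' := objective A (12 * w) g h x' (expWeights (exponent A (12 * w) h x'))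
    have h6 : Ψ' ≤ objective A (12 * w) g h x y := by
      have : 0 ≤ 12 * w * relEntropy y (expWeights (exponent A (12 * w) h x')) := by positivity
      linarith
    have h7 : (1 : ℝ) ≤ 2 ^ k := one_le_pow₀ (by norm_num)
    have h8 := mul_le_mul_of_nonneg_left h6 (sub_nonneg.2 h7)
    have h9 := mul_le_mul_of_nonneg_left h1 (zero_le_one.trans h7)
    rw [pow_succ]
    linarith

theorem relEntropy_uniform {y : I → ℝ} (hy : ∑ i, y i = 1) :
    relEntropy y (fun _ => 1 / (Fintype.card I : ℝ)) =
      ∑ i, y i * Real.log (y i) + Real.log (Fintype.card I) := by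
  simp only [relEntropy, one_div, Real.log_inv, sub_neg_eq_add, mul_add, sum_add_distrib,
    ← sum_mul, hy, one_mul]

theorem sum_mul_log_nonpos {y : I → ℝ} (hy : ∀ i, 0 ≤ y i) (hs : ∑ i, y i = 1) :
    ∑ i, y i * Real.log (y i) ≤ 0 :=
  sum_nonpos fun i _ => mul_nonpos_of_nonneg_of_nonpos (hy i)
    (Real.log_nonpos (hy i) (hs ▸ single_le_sum (fun i _ => hy i) (mem_univ i)))

theorem neg_log_card_le [Nonempty I] {y : I → ℝ} (hy : ∀ i, 0 ≤ y i) (hs : ∑ i, y i = 1) :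
    - Real.log (Fintype.card I) ≤ ∑ i, y i * Real.log (y i) := by
  have hc : (0 : ℝ) < Fintype.card I := by exact_mod_cast Fintype.card_pos
  have h1 := relEntropy_nonneg (y := fun _ : I => 1 / (Fintype.card I : ℝ)) hy
    (fun i => by positivity) (by rw [hs]; simp [hc.ne'])
  rw [relEntropy_uniform hs] at h1
  linarith

/-- The gap has coefficient `2 ^ 0 - 1 = 0`, so the starting point of the box is irrelevant. -/
theorem AlternatingInv.init [Nonempty I] (A : I → J → ℝ) (w : ℝ) (g : J → ℝ) (h : I → ℝ) :
    AlternatingInv A w g h (fun _ => 1 / (Fintype.card I : ℝ)) 0 (fun _ => 0)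
      (fun _ => 1 / (Fintype.card I : ℝ)) := by
  have hc : (0 : ℝ) < Fintype.card I := by exact_mod_cast Fintype.card_pos
  exact ⟨by simp, fun _ => by positivity, by simp [hc.ne'], by simp⟩

theorem AlternatingInv.inDomain {A : I → J → ℝ} {w : ℝ} {g : J → ℝ} {h : I → ℝ} {y₀ : I → ℝ}
    {k : ℕ} {x : J → ℝ} {y : I → ℝ} (H : AlternatingInv A w g h y₀ k x y) : InDomain x y :=
  ⟨H.box, fun i => (H.pos i).le, H.sum⟩

/-- The relative entropy to the uniform distribution is at most the logarithm of the number of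
constraints. The constant is `576 = 6 · 96`. -/
theorem AlternatingInv.objective_le [Nonempty I] {A : I → J → ℝ} {w ε : ℝ} (hw : 0 < w)
    (hε : 0 < ε) {g : J → ℝ} {h : I → ℝ} {k : ℕ} {x x' : J → ℝ} {y y' : I → ℝ}
    (H : AlternatingInv A w g h (fun _ => 1 / (Fintype.card I : ℝ)) k x y) (hu : InDomain x' y')
    (hk : 1 + 576 * w * (1 + Real.log (Fintype.card I)) / ε ≤ 2 ^ k) :
    objective A (12 * w) g h x y ≤ objective A (12 * w) g h x' y' + ε / 96 := by
  have hc : (1 : ℝ) ≤ Fintype.card I := by exact_mod_cast Fintype.card_pos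
  have hL : 0 ≤ Real.log (Fintype.card I) := Real.log_nonneg hc
  have h1 := H.bound x' y' hu
  rw [relEntropy_uniform hu.sum] at h1
  have h2 := relEntropy_nonneg hu.nonneg H.pos (hu.sum.trans H.sum.symm)
  have h3 := sum_mul_log_nonpos hu.nonneg hu.sum
  have h4 : 0 ≤ 6 * w * 2 ^ k * relEntropy y' y := by positivity
  by_contra! hlt
  set Δ := objective A (12 * w) g h x y - objective A (12 * w) g h x' y'
  have h5 : ε / 96 < Δ := by simp only [Δ]; linarith
  have h6 : 6 * w * (1 + Real.log (Fintype.card I)) < (2 ^ k - 1) * Δ := by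
    have h7 : 0 < 576 * w * (1 + Real.log (Fintype.card I)) / ε := by positivity
    calc 6 * w * (1 + Real.log (Fintype.card I))
        = 576 * w * (1 + Real.log (Fintype.card I)) / ε * (ε / 96) := by field_simp; ring
      _ < 576 * w * (1 + Real.log (Fintype.card I)) / ε * Δ := mul_lt_mul_of_pos_left h5 h7
      _ ≤ (2 ^ k - 1) * Δ := mul_le_mul_of_nonneg_right (by linarith) (by linarith)
  nlinarith

/-! ### Error accumulation in the extragradient method -/

theorem regularizer_le {A : I → J → ℝ} {w : ℝ} (hw : 0 ≤ w) (hA : ∀ i, ∑ j, |A i j| ≤ w)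
    {x : J → ℝ} {y : I → ℝ} (h : InDomain x y) : regularizer A (12 * w) x y ≤ w := by
  have h1 : ∑ i, y i * ∑ j, |A i j| * x j ^ 2 ≤ ∑ i, y i * w := by
    refine sum_le_sum fun i _ => mul_le_mul_of_nonneg_left ((sum_le_sum fun j _ => ?_).trans (hA i))
      (h.nonneg i)
    exact mul_le_of_le_one_right (abs_nonneg _) (pow_le_one₀ (h.box j).1 (h.box j).2)
  rw [← sum_mul, h.sum, one_mul] at h1
  have := mul_nonpos_of_nonneg_of_nonpos (show 0 ≤ 12 * w by positivity) (sum_mul_log_nonpos h.nonneg h.sum)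
  rw [regularizer]
  linarith

theorem le_regularizer [Nonempty I] {A : I → J → ℝ} {w : ℝ} (hw : 0 ≤ w) {x : J → ℝ} {y : I → ℝ}
    (h : InDomain x y) :
    -(12 * w * Real.log (Fintype.card I)) ≤ regularizer A (12 * w) x y := by
  have h1 : 0 ≤ ∑ i, y i * ∑ j, |A i j| * x j ^ 2 :=
    sum_nonneg fun i _ => mul_nonneg (h.nonneg i) (sum_nonneg fun j _ => by positivity)
  have := mul_le_mul_of_nonneg_left (neg_log_card_le h.nonneg h.sum) (show 0 ≤ 12 * w by positivity)
  rw [regularizer]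
  linarith

/-- The state of the extragradient method after `t` rounds. -/
structure ExtragradientInv (A : I → J → ℝ) (b : I → ℝ) (w ε : ℝ) (t : ℕ) (X : J → ℝ) (Y : I → ℝ) :
    Prop where
  box : ∀ j, 0 ≤ X j ∧ X j ≤ t
  nonneg : ∀ i, 0 ≤ Y i
  sum : ∑ i, Y i = t
  bound : ∀ x y, InDomain x y → -(12 * w * Real.log (Fintype.card I)) - ε / 48 * t ≤
    regularizer A (12 * w) x y - regret A b t X Y x y / 24

theorem ExtragradientInv.init [Nonempty I] (A : I → J → ℝ) (b : I → ℝ) {w : ℝ} (hw : 0 ≤ w)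
    (ε : ℝ) : ExtragradientInv A b w ε 0 (fun _ => 0) (fun _ => 0) :=
  ⟨by simp, by simp, by simp, fun x y h => by simpa [regret] using le_regularizer hw h⟩

/-- Up to an error, `(x, y)` is the reply of the regularized player to the sums `X` and `Y`. -/
structure IsReply (A : I → J → ℝ) (b : I → ℝ) (w ε t : ℝ) (X : J → ℝ) (Y : I → ℝ) (x : J → ℝ)
    (y : I → ℝ) : Prop where
  dom : InDomain x y
  bound : ∀ x' y', InDomain x' y' → regularizer A (12 * w) x y - regret A b t X Y x y / 24 ≤
    regularizer A (12 * w) x' y' - regret A b t X Y x' y' / 24 + ε / 96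

/-- The old bound is applied at the first reply `(xp, yp)`, whose value bounds the new potential
from below up to two minimization errors, `2 · ε/96 = ε/48`. -/
theorem ExtragradientInv.step {A : I → J → ℝ} {b : I → ℝ} {w ε : ℝ}
    (hA : ∀ i, ∑ j, |A i j| ≤ w) {t : ℕ} {X xp xq : J → ℝ} {Y yp yq : I → ℝ}
    (H : ExtragradientInv A b w ε t X Y) (hp : IsReply A b w ε t X Y xp yp)
    (hq : IsReply A b w ε (t + 2) (fun j => X j + 2 * xp j) (fun i => Y i + 2 * yp i) xq yq) :
    ExtragradientInv A b w ε (t + 1) (fun j => X j + xq j) (fun i => Y i + yq i) where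
  box j := by
    have h1 := H.box j
    have h2 := hq.dom.box j
    push_cast
    constructor <;> linarith
  nonneg i := add_nonneg (H.nonneg i) (hq.dom.nonneg i)
  sum := by rw [sum_add_distrib, H.sum, hq.dom.sum]; push_cast; rfl
  bound x y h := by
    have h1 := extragradient_step hA hp.dom hq.dom h hp.bound hq.bound
    have h2 := H.bound xp yp hp.dom
    push_cast
    linarith

/-- The accumulated error contributes `24 · ε/48 · t = ε t / 2`. The range of the regularizer
contributes at most `288 w (1 + log m)`, with `m` the number of constraints, and `ht` makes this the
other half. -/
theorem ExtragradientInv.regret_le {A : I → J → ℝ} {b : I → ℝ} {w ε : ℝ} (hw : 0 ≤ w) (hε : 0 < ε)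
    (hA : ∀ i, ∑ j, |A i j| ≤ w) {t : ℕ} {X : J → ℝ} {Y : I → ℝ}
    (H : ExtragradientInv A b w ε t X Y)
    (ht : 576 * w * (1 + Real.log (Fintype.card I)) / ε ≤ t) {x : J → ℝ} {y : I → ℝ}
    (h : InDomain x y) : regret A b t X Y x y ≤ ε * t := by
  have h1 := H.bound x y h
  have h2 := regularizer_le hw hA h
  rw [div_le_iff₀ hε] at ht
  linarith

end Alternating

/-! ### Reasoning about programs -/

/-- The destination of an instruction; the first component tells real registers (`false`) from
index registers (`true`). -/
def Instr.dest : Instr → Bool × ℕ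
  | .realConst d _ => (false, d)
  | .indexConst d _ => (true, d)
  | .realMap d _ _ => (false, d)
  | .realZip d _ _ _ => (false, d)
  | .indexZip d _ _ _ => (true, d)
  | .toReal d _ => (false, d)
  | .iota d _ => (true, d)
  | .count d _ => (true, d)
  | .realGather d _ _ => (false, d)
  | .indexGather d _ _ => (true, d)
  | .combine d _ _ _ _ => (false, d)

def Instr.reads : Instr → List (Bool × ℕ)
  | .realConst _ _ => []
  | .indexConst _ _ => []
  | .realMap _ _ a => [(false, a)]
  | .realZip _ _ a b => [(false, a), (false, b)]
  | .indexZip _ _ a b => [(true, a), (true, b)]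
  | .toReal _ a => [(true, a)]
  | .iota _ a => [(true, a)]
  | .count _ a => [(true, a)]
  | .realGather _ a i => [(false, a), (true, i)]
  | .indexGather _ a i => [(true, a), (true, i)]
  | .combine _ _ b i v => [(false, b), (true, i), (false, v)]

/-- The destination register contains the result of the instruction. -/
def Instr.Holds (s : State) : Instr → Prop
  | .realConst d q => s.real d = [(q : ℝ)]
  | .indexConst d k => s.index d = [k]
  | .realMap d op a => s.real d = (s.real a).map op.eval
  | .realZip d op a b => s.real d = List.zipWith op.eval (s.real a) (s.real b)
  | .indexZip d op a b => s.index d = List.zipWith op.eval (s.index a) (s.index b)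
  | .toReal d a => s.real d = (s.index a).map fun k : ℕ => (k : ℝ)
  | .iota d a => s.index d = List.range ((s.index a).getD 0 0)
  | .count d a => s.index d = [(s.index a).length]
  | .realGather d a i => s.real d = (s.index i).map fun k => (s.real a).getD k 0
  | .indexGather d a i => s.index d = (s.index i).map fun k => (s.index a).getD k 0
  | .combine d op b i v => s.real d = combineByKey op (s.real b) (s.index i) (s.real v)

theorem Instr.run_real_of_ne {s : State} {i : Instr} {r : ℕ} (h : i.dest ≠ (false, r)) :
    (i.run s).real r = s.real r := by
  cases i <;> simp [Instr.run, State.setReal, State.setIndex, Instr.dest, Function.update_apply]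
    at h ⊢ <;> intro hr <;> exact absurd hr.symm h

theorem Instr.run_index_of_ne {s : State} {i : Instr} {r : ℕ} (h : i.dest ≠ (true, r)) :
    (i.run s).index r = s.index r := by
  cases i <;> simp [Instr.run, State.setReal, State.setIndex, Instr.dest, Function.update_apply]
    at h ⊢ <;> intro hr <;> exact absurd hr.symm h

theorem Instr.holds_congr {s s' : State} {i : Instr}
    (hr : ∀ r, i.dest = (false, r) ∨ (false, r) ∈ i.reads → s'.real r = s.real r)
    (hi : ∀ r, i.dest = (true, r) ∨ (true, r) ∈ i.reads → s'.index r = s.index r)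
    (h : i.Holds s) : i.Holds s' := by
  cases i <;> simp only [Instr.Holds, Instr.dest, Instr.reads] at hr hi h ⊢ <;>
    simp [hr, hi, h]

theorem Instr.holds_run (s : State) {i : Instr} (h : i.dest ∉ i.reads) : i.Holds (i.run s) := by
  cases i <;> simp [Instr.Holds, Instr.run, State.setReal, State.setIndex, Instr.dest,
    Instr.reads, Function.update_apply] at h ⊢ <;> grind [List.map_eq_flatMap]

/-! ### Straight-line code as a system of equations -/

noncomputable def runAll (s : State) (l : List Instr) : State := l.foldl Instr.run s

/-- No instruction overwrites its own sources, or what an earlier instruction read or wrote. -/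
def singleAssignment : List Instr → Bool
  | [] => true
  | i :: l => decide (i.dest ∉ i.reads) &&
      l.all (fun j => decide (j.dest ≠ i.dest) && decide (j.dest ∉ i.reads)) && singleAssignment l

theorem runAll_real_of_ne {l : List Instr} {s : State} {r : ℕ}
    (h : l.all (fun i => decide (i.dest ≠ (false, r))) = true) :
    (runAll s l).real r = s.real r := by
  induction l generalizing s with
  | nil => rfl
  | cons i l ih =>
    simp only [List.all_cons, Bool.and_eq_true, decide_eq_true_eq] at h
    rw [runAll, List.foldl_cons, ← runAll, ih h.2, Instr.run_real_of_ne h.1]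

theorem runAll_index_of_ne {l : List Instr} {s : State} {r : ℕ}
    (h : l.all (fun i => decide (i.dest ≠ (true, r))) = true) :
    (runAll s l).index r = s.index r := by
  induction l generalizing s with
  | nil => rfl
  | cons i l ih =>
    simp only [List.all_cons, Bool.and_eq_true, decide_eq_true_eq] at h
    rw [runAll, List.foldl_cons, ← runAll, ih h.2, Instr.run_index_of_ne h.1]

/-- Under single assignment later instructions disturb neither the result nor the sources of an
earlier one, so its equation, once established, survives to the end. -/
theorem holds_runAll {l : List Instr} (h : singleAssignment l = true) (s : State) :
    ∀ i ∈ l, i.Holds (runAll s l) := by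
  induction l generalizing s with
  | nil => simp
  | cons i l ih =>
    simp only [singleAssignment, Bool.and_eq_true, decide_eq_true_eq, List.all_eq_true] at h
    obtain ⟨⟨h1, h2⟩, h3⟩ := h
    intro j hj
    rw [runAll, List.foldl_cons, ← runAll]
    rcases List.mem_cons.1 hj with rfl | hj
    · refine Instr.holds_congr (fun r hr => runAll_real_of_ne ?_)
        (fun r hr => runAll_index_of_ne ?_) (Instr.holds_run s h1) <;>
      · rw [List.all_eq_true]
        intro k hk
        have := h2 k hk
        rcases hr with hr | hr
        · rw [decide_eq_true_eq, ← hr]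
          exact this.1
        · rw [decide_eq_true_eq]
          rintro he
          exact this.2 (he ▸ hr)
    · exact ih h3 _ j hj

/-! ### Counting steps on vectors of bounded length -/

/-- All registers have at most `B` entries. -/
def State.Bounded (B : ℕ) (s : State) : Prop :=
  ∀ r, (s.real r).length ≤ B ∧ (s.index r).length ≤ B

/-- The instruction creates at most `B` entries. -/
def Instr.Fits (B : ℕ) (s : State) : Instr → Prop
  | .iota _ a => (s.index a).getD 0 0 ≤ B
  | _ => True

def Instr.isIota : Instr → Bool
  | .iota _ _ => true
  | _ => false

theorem Instr.fits_of_not_isIota {B : ℕ} {s : State} {i : Instr} (h : i.isIota = false) :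
    i.Fits B s := by
  cases i <;> simp_all [Instr.isIota, Instr.Fits]

theorem State.Bounded.setReal {B : ℕ} {s : State} (h : s.Bounded B) {v : List ℝ}
    (hv : v.length ≤ B) (d : ℕ) : (s.setReal d v).Bounded B := by
  intro r
  refine ⟨?_, (h r).2⟩
  simp only [State.setReal, Function.update_apply]
  split_ifs
  exacts [hv, (h r).1]

theorem State.Bounded.setIndex {B : ℕ} {s : State} (h : s.Bounded B) {v : List ℕ}
    (hv : v.length ≤ B) (d : ℕ) : (s.setIndex d v).Bounded B := by
  intro r
  refine ⟨(h r).1, ?_⟩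
  simp only [State.setIndex, Function.update_apply]
  split_ifs
  exacts [hv, (h r).2]

/-- Only `iota` can produce a vector whose length is not fixed or inherited from a source; hence the
side condition `Fits`. -/
theorem State.Bounded.run {B : ℕ} (hB : 1 ≤ B) {s : State} (h : s.Bounded B) {i : Instr}
    (hi : i.Fits B s) : (i.run s).Bounded B := by
  cases i
  case realConst => exact h.setReal (by simpa) _
  case indexConst => exact h.setIndex (by simpa) _
  case realMap d op a => exact h.setReal (by simpa using (h a).1) _
  case realZip d op a b => exact h.setReal (by simp [(h a).1]) _
  case indexZip d op a b => exact h.setIndex (by simp [(h a).2]) _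
  case toReal d a => exact h.setReal (by simpa using (h a).2) _
  case iota d a => exact h.setIndex (by simpa [Instr.Fits] using hi) _
  case count => exact h.setIndex (by simpa) _
  case realGather d a i => exact h.setReal (by simpa using (h i).2) _
  case indexGather d a i => exact h.setIndex (by simpa using (h i).2) _
  case combine d op b i v => exact h.setReal (by simpa [combineByKey] using (h b).1) _

theorem Instr.size_le {B : ℕ} (hB : 1 ≤ B) {s : State} (h : s.Bounded B) {i : Instr}
    (hi : i.Fits B s) : i.size s ≤ 3 * B := by
  cases i <;> simp only [Instr.size, Instr.Fits] at hi ⊢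
  case realMap d op a => have := (h a).1; omega
  case realZip d op a b => have := (h a).1; have := (h b).1; omega
  case indexZip d op a b => have := (h a).2; have := (h b).2; omega
  case toReal d a => have := (h a).2; omega
  case realGather d a i => have := (h i).2; omega
  case indexGather d a i => have := (h i).2; omega
  case combine d op b i v => have := (h b).1; have := (h i).2; have := (h v).1; omega
  all_goals omega

/-- A bound for the depth of an instruction in a state bounded by `B`. -/
def depthBound (B : ℕ) : ℕ := 1 + Nat.clog 2 (1 + 3 * B)

theorem one_le_depthBound (B : ℕ) : 1 ≤ depthBound B := Nat.le_add_right _ _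

theorem Instr.depth_le {B : ℕ} (hB : 1 ≤ B) {s : State} (h : s.Bounded B) {i : Instr}
    (hi : i.Fits B s) : i.depth s ≤ depthBound B := by
  have hs := Instr.size_le hB h hi
  cases i
  case combine d op b i v =>
    exact Nat.add_le_add_left (Nat.clog_mono_right 2 (Nat.add_le_add_left hs 1)) 1
  all_goals exact one_le_depthBound B

/-- Started in `s`, the program halts after at most `n` steps, each of them affordable for vectors
of length `B`, in a state that satisfies `Q`. -/
def Attains (B : ℕ) (A : Prog) (s : State) (n : ℕ) (Q : State → Prop) : Prop :=
  ∃ s' T W, Exec A s s' T W ∧ s'.Bounded B ∧ T ≤ n * depthBound B ∧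
    W ≤ n * ((1 + 3 * B) * depthBound B) ∧ Q s'

theorem Attains.mono {B : ℕ} {A : Prog} {s : State} {n n' : ℕ} {Q Q' : State → Prop}
    (h : Attains B A s n Q) (hn : n ≤ n') (hQ : ∀ s', Q s' → Q' s') : Attains B A s n' Q' := by
  obtain ⟨s', T, W, hE, hB, hT, hW, hs'⟩ := h
  exact ⟨s', T, W, hE, hB, hT.trans (Nat.mul_le_mul_right _ hn),
    hW.trans (Nat.mul_le_mul_right _ hn), hQ _ hs'⟩

theorem Attains.instr {B : ℕ} (hB : 1 ≤ B) {s : State} (h : s.Bounded B) {i : Instr}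
    (hi : i.Fits B s) : Attains B (.instr i) s 1 fun s' => s' = i.run s := by
  refine ⟨_, _, _, .instr i s, h.run hB hi, ?_, ?_, rfl⟩
  · simpa using Instr.depth_le hB h hi
  · rw [one_mul]
    exact Nat.mul_le_mul (Nat.add_le_add_left (Instr.size_le hB h hi) 1) (Instr.depth_le hB h hi)

theorem Attains.seq {B : ℕ} {A A' : Prog} {s : State} {n n' : ℕ} {Q Q' : State → Prop}
    (h : Attains B A s n Q) (h' : ∀ s', s'.Bounded B → Q s' → Attains B A' s' n' Q') :
    Attains B (.seq A A') s (n + n') Q' := by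
  obtain ⟨s', T, W, hE, hB, hT, hW, hs'⟩ := h
  obtain ⟨s'', T', W', hE', hB', hT', hW', hs''⟩ := h' s' hB hs'
  exact ⟨s'', _, _, .seq hE hE', hB', by rw [Nat.add_mul]; omega, by rw [Nat.add_mul]; omega, hs''⟩

/-- A loop that counts down from the value `v` of the register `a`. -/
theorem Attains.loop {B : ℕ} {A : Prog} {n a : ℕ} {v : ℝ} {Inv : ℕ → State → Prop}
    (hcount : ∀ k s, Inv k s → (s.real a).getD 0 0 = v - k)
    (hstep : ∀ k s, s.Bounded B → Inv k s → Attains B A s n (Inv (k + 1)))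
    {s : State} (hs : s.Bounded B) (h : Inv 0 s) :
    Attains B (.loop a A) s (⌈v⌉₊ * (n + 1) + 1) fun s' => ∃ k : ℕ, v ≤ k ∧ Inv k s' := by
  have hD := one_le_depthBound B
  have hD' : 1 ≤ (1 + 3 * B) * depthBound B := Nat.mul_pos (by omega) hD
  -- Induction on the number `m` of rounds still allowed; the counter `v - k` is real, so the loop
  -- may end as soon as `k` reaches `⌈v⌉₊`.
  suffices H : ∀ m k s, s.Bounded B → Inv k s → ⌈v⌉₊ ≤ k + m →
      Attains B (.loop a A) s (m * (n + 1) + 1) fun s' => ∃ k : ℕ, v ≤ k ∧ Inv k s' from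
    H _ 0 s hs h (by simp)
  intro m
  induction m with
  | zero =>
    intro k s hs h hk
    have hv : v ≤ k := Nat.ceil_le.1 hk
    refine ⟨s, 1, 1, .loopFalse ?_, hs, by simpa using hD, by simpa using hD', k, hv, h⟩
    rw [State.test, hcount k s h]
    linarith
  | succ m ih =>
    intro k s hs h hk
    by_cases hv : v ≤ k
    · refine ⟨s, 1, 1, .loopFalse ?_, hs, hD.trans (Nat.le_mul_of_pos_left _ (by omega)),
        hD'.trans (Nat.le_mul_of_pos_left _ (by omega)), k, hv, h⟩
      rw [State.test, hcount k s h]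
      linarith
    · obtain ⟨s', T, W, hE, hB, hT, hW, hs'⟩ := hstep k s hs h
      obtain ⟨s'', T', W', hE', hB', hT', hW', hs''⟩ := ih (k + 1) s' hB hs' (by omega)
      refine ⟨s'', _, _, .loopTrue ?_ hE hE', hB', ?_, ?_, hs''⟩
      · rw [State.test, hcount k s h]
        push Not at hv
        linarith
      · calc 1 + T + T' ≤ depthBound B + n * depthBound B + (m * (n + 1) + 1) * depthBound B := by
              omega
          _ = _ := by ring
      · calc 1 + W + W' ≤ (1 + 3 * B) * depthBound B + n * ((1 + 3 * B) * depthBound B) +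
              (m * (n + 1) + 1) * ((1 + 3 * B) * depthBound B) := by omega
          _ = _ := by ring

/-- A nonempty sequence of instructions. -/
def block : List Instr → Prog
  | [] => .instr (.realConst 0 0)
  | [i] => .instr i
  | i :: j :: l => .seq (.instr i) (block (j :: l))

theorem Attains.block {B : ℕ} (hB : 1 ≤ B) {s : State} (hs : s.Bounded B) {l : List Instr}
    (hl : l ≠ []) (hi : l.all (fun j => !j.isIota) = true) :
    Attains B (block l) s l.length fun s' => s' = runAll s l := by
  induction l generalizing s with
  | nil => exact absurd rfl hl
  | cons i l ih =>
    rw [List.all_cons, Bool.and_eq_true, Bool.not_eq_true'] at hi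
    have h := Attains.instr hB hs (Instr.fits_of_not_isIota hi.1)
    cases l with
    | nil => exact h
    | cons j l =>
      rw [List.length_cons, Nat.add_comm _ 1]
      refine h.seq fun s' hs' h => ?_
      subst h
      exact ih hs' (by simp) hi.2

/-- The real registers below `k` and the index registers are the same in both states. -/
def Keeps (k : ℕ) (s s' : State) : Prop :=
  (∀ r < k, s'.real r = s.real r) ∧ s'.index = s.index

theorem Keeps.trans {k : ℕ} {s s' s'' : State} (h : Keeps k s s') (h' : Keeps k s' s'') :
    Keeps k s s'' :=
  ⟨fun r hr => (h'.1 r hr).trans (h.1 r hr), h'.2.trans h.2⟩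

/-- The program writes no index register, and only real registers from `k` on. -/
def Prog.writesFrom (k : ℕ) : Prog → Bool
  | .instr i => !i.dest.1 && decide (k ≤ i.dest.2)
  | .seq A B => A.writesFrom k && B.writesFrom k
  | .ite _ A B => A.writesFrom k && B.writesFrom k
  | .loop _ A => A.writesFrom k

theorem Exec.keeps {k : ℕ} {A : Prog} {s s' : State} {T W : ℕ} (h : Exec A s s' T W)
    (hA : A.writesFrom k = true) : Keeps k s s' := by
  induction h with
  | instr i s =>
    simp only [Prog.writesFrom, Bool.and_eq_true, Bool.not_eq_true', decide_eq_true_eq] at hA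
    refine ⟨fun r hr => Instr.run_real_of_ne ?_, funext fun r => Instr.run_index_of_ne ?_⟩
    · intro h
      rw [h] at hA
      simp only at hA
      omega
    · intro h
      rw [h] at hA
      simp at hA
  | seq _ _ ih ih' =>
    simp only [Prog.writesFrom, Bool.and_eq_true] at hA
    exact (ih hA.1).trans (ih' hA.2)
  | iteTrue _ _ ih =>
    simp only [Prog.writesFrom, Bool.and_eq_true] at hA
    exact ih hA.1
  | iteFalse _ _ ih =>
    simp only [Prog.writesFrom, Bool.and_eq_true] at hA
    exact ih hA.2
  | loopTrue _ _ _ ih ih' => exact (ih hA).trans (ih' hA)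
  | loopFalse _ => exact ⟨fun _ _ => rfl, rfl⟩

theorem Attains.keeps {B k : ℕ} {A : Prog} {s : State} {n : ℕ} {Q : State → Prop}
    (h : Attains B A s n Q) (hA : A.writesFrom k = true) :
    Attains B A s n fun s' => Q s' ∧ Keeps k s s' := by
  obtain ⟨s', T, W, hE, hB, hT, hW, hs'⟩ := h
  exact ⟨s', T, W, hE, hB, hT, hW, hs', hE.keeps hA⟩

theorem runAll_keeps {k : ℕ} {l : List Instr} {s : State}
    (h : l.all (fun i => !i.dest.1 && decide (k ≤ i.dest.2)) = true) : Keeps k s (runAll s l) := by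
  induction l generalizing s with
  | nil => exact ⟨fun _ _ => rfl, rfl⟩
  | cons i l ih =>
    rw [List.all_cons, Bool.and_eq_true] at h
    exact ((Exec.instr i s).keeps h.1).trans (ih h.2)

/-! ### Vector operations -/

theorem zipWith_ofFn {α β γ : Type*} {m : ℕ} (f : α → β → γ) (u : Fin m → α) (v : Fin m → β) :
    List.zipWith f (List.ofFn u) (List.ofFn v) = List.ofFn fun i => f (u i) (v i) := by
  apply List.ext_getElem <;> simp

theorem zipWith_map_map {α β γ δ : Type*} (f : α → β → γ) (l : List δ) (u : δ → α) (v : δ → β) :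
    List.zipWith f (l.map u) (l.map v) = l.map fun e => f (u e) (v e) := by
  rw [List.zipWith_map, List.zipWith_self]

theorem map_getD_ofFn {δ : Type*} {m : ℕ} (l : List δ) (key : δ → Fin m) (f : Fin m → ℝ) :
    ((l.map fun e => (key e : ℕ)).map fun k => (List.ofFn f).getD k 0) =
      l.map fun e => f (key e) := by
  simp

/-- Reading at a vector of zero indices broadcasts a scalar. -/
theorem map_getD_zero {m : ℕ} (a : ℝ) :
    ((List.ofFn fun _ : Fin m => 0).map fun k => [a].getD k 0) = List.ofFn fun _ : Fin m => a := by
  rw [List.map_ofFn]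
  rfl

theorem range_eq_ofFn (m : ℕ) : List.range m = List.ofFn fun i : Fin m => (i : ℕ) := by
  apply List.ext_getElem <;> simp

theorem combineByKey_ofFn {δ : Type*} {m : ℕ} (op : CombineOp) (base : Fin m → ℝ) (l : List δ)
    (key : δ → Fin m) (v : δ → ℝ) :
    combineByKey op (List.ofFn base) (l.map fun e => (key e : ℕ)) (l.map v) =
      List.ofFn fun i => ((l.filter fun e => key e = i).map v).foldl op.eval (base i) := by
  apply List.ext_getElem
  · simp [combineByKey]
  · intro i h1 h2
    have hi : i < m := by simpa [combineByKey] using h1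
    simp only [combineByKey, List.getElem_mapIdx, List.getElem_ofFn, List.zip_map', List.filter_map,
      List.map_map]
    congr 2
    refine List.filter_congr fun e _ => ?_
    simp [Fin.ext_iff]

/-- Writing everything to address `0` is a reduction; the program obtains sums and maxima of whole
vectors this way. -/
theorem combineByKey_singleton {m : ℕ} (op : CombineOp) (b : ℝ) (v : Fin m → ℝ) :
    combineByKey op [b] (List.ofFn fun _ : Fin m => 0) (List.ofFn v) =
      [(List.ofFn v).foldl op.eval b] := by
  have h := combineByKey_ofFn op (fun _ : Fin 1 => b) (List.finRange m) (fun _ => 0) v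
  simpa [List.ofFn_eq_map] using h

theorem foldl_add_eq (l : List ℝ) (b : ℝ) : l.foldl CombineOp.add.eval b = b + l.sum := by
  induction l generalizing b with
  | nil => simp
  | cons a l ih => rw [List.foldl_cons, ih, List.sum_cons, CombineOp.eval, add_assoc]

theorem foldl_max_le (l : List ℝ) (b u : ℝ) :
    l.foldl CombineOp.max.eval b ≤ u ↔ b ≤ u ∧ ∀ a ∈ l, a ≤ u := by
  induction l generalizing b with
  | nil => simp
  | cons a l ih => simp [ih, CombineOp.eval, and_assoc]

theorem combineByKey_sum {m : ℕ} (b : ℝ) (v : Fin m → ℝ) :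
    combineByKey .add [b] (List.ofFn fun _ : Fin m => 0) (List.ofFn v) = [b + ∑ i, v i] := by
  rw [combineByKey_singleton, foldl_add_eq, List.sum_ofFn]

/-- The product of a matrix that is given by the list of its nonzero entries with a vector. -/
theorem combineByKey_row {m n : ℕ} {A : Matrix (Fin m) (Fin n) ℝ} {l : List (Fin m × Fin n)}
    (hl : Lists A l) (base : Fin m → ℝ) (f : Fin n → ℝ) :
    combineByKey .add (List.ofFn base) (l.map fun e => (e.1 : ℕ))
      (l.map fun e => A e.1 e.2 * f e.2) = List.ofFn fun i => base i + ∑ j, A i j * f j := by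
  rw [combineByKey_ofFn]
  refine congrArg List.ofFn (funext fun i => ?_)
  rw [foldl_add_eq, ← List.sum_toFinset _ (hl.1.filter _), List.toFinset_filter]
  congr 1
  have : l.toFinset = univ.filter fun e : Fin m × Fin n => A e.1 e.2 ≠ 0 := by
    ext e; simp [hl.2]
  rw [this, filter_filter, sum_filter, Fintype.sum_prod_type, sum_eq_single i]
  · refine sum_congr rfl fun j _ => ?_
    by_cases h : A i j = 0 <;> simp [h]
  · intro i' _ h
    simp [h]
  · simp

theorem combineByKey_column {m n : ℕ} {A : Matrix (Fin m) (Fin n) ℝ} {l : List (Fin m × Fin n)}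
    (hl : Lists A l) (base : Fin n → ℝ) (f : Fin m → ℝ) :
    combineByKey .add (List.ofFn base) (l.map fun e => (e.2 : ℕ))
      (l.map fun e => A e.1 e.2 * f e.1) = List.ofFn fun j => base j + ∑ i, A i j * f i := by
  rw [combineByKey_ofFn]
  refine congrArg List.ofFn (funext fun j => ?_)
  rw [foldl_add_eq, ← List.sum_toFinset _ (hl.1.filter _), List.toFinset_filter]
  congr 1
  have : l.toFinset = univ.filter fun e : Fin m × Fin n => A e.1 e.2 ≠ 0 := by
    ext e; simp [hl.2]
  rw [this, filter_filter, sum_filter, Fintype.sum_prod_type_right, sum_eq_single j]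
  · refine sum_congr rfl fun i _ => ?_
    by_cases h : A i j = 0 <;> simp [h]
  · intro i' _ h
    simp [h]
  · simp

/-! ### The program -/

/-- Kept apart from `setup` because the cost of `iota` depends on register contents, and
`Attains.block` excludes it. -/
def indexSetup : List Instr := [.iota 7 4, .iota 9 5, .iota 11 6]

/-- Constants, the width, the numbers of rounds, and the initial sums. -/
def setup : List Instr :=
  -- An index vector minus itself gives zero addresses, for broadcasting and for reductions.
  [.indexZip 8 .sub 7 7, .indexZip 10 .sub 9 9, .indexZip 12 .sub 11 11,
   .realConst 9 0, .realConst 4 1, .realConst 5 2, .realConst 6 12, .realConst 7 24,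
   .realConst 8 576,
   .realGather 10 9 8, .realGather 11 9 10, .realGather 12 9 12,
   .realGather 13 4 8, .realGather 14 4 10, .realGather 15 4 12,
   .combine 16 .add 11 0 0, .combine 17 .add 12 2 1, .combine 18 .max 4 10 16,
   .combine 19 .max 18 12 17,
   .toReal 20 5, .toReal 21 6, .realZip 22 .add 20 21, .realMap 23 .log 22, .realZip 24 .add 4 23,
   .realZip 25 .mul 19 24, .realZip 26 .mul 8 25, .realZip 27 .div 26 2, .realZip 28 .add 4 27,
   .realMap 29 .log 28, .realZip 30 .mul 5 29, .realZip 31 .mul 6 19,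
   .realGather 32 31 10, .realGather 33 31 12, .realZip 34 .div 4 22,
   .realGather 37 7 8, .realGather 38 7 10, .realGather 39 7 12,
   .realGather 40 9 8, .realGather 41 9 10, .realGather 42 9 12, .realZip 43 .add 9 9,
   .realZip 44 .add 27 9]

/-- The linear terms for the sums in the registers 50 to 53, and the start of the alternating
minimization. -/
def replySetup : List Instr :=
  [.realGather 70 51 0, .realZip 71 .mul 0 70, .combine 72 .add 10 1 71,
   .realGather 73 52 2, .realZip 74 .mul 1 73, .combine 75 .add 10 3 74,
   .realZip 76 .sub 75 72, .realZip 64 .div 76 37,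
   .realGather 77 50 1, .realZip 78 .mul 0 77, .combine 79 .add 11 0 78,
   .realGather 80 50 3, .realZip 81 .mul 1 80, .combine 82 .add 12 2 81,
   .realGather 83 53 10, .realGather 84 53 12,
   .realZip 85 .sub 79 83, .realZip 65 .div 85 38, .realZip 86 .sub 84 82, .realZip 66 .div 86 39,
   .realGather 60 9 8, .realGather 61 34 10, .realGather 62 34 12, .realZip 63 .add 30 9]

/-- One round of the alternating minimization. -/
def replyStep : List Instr :=
  [.realGather 70 61 0, .realZip 71 .mul 0 70, .combine 72 .add 10 1 71,
   .realGather 73 62 2, .realZip 74 .mul 1 73, .combine 75 .add 72 3 74,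
   .realZip 76 .add 75 75, .realZip 87 .div 64 76, .realZip 88 .min 87 13, .realZip 60 .max 88 10,
   .realZip 89 .mul 60 60,
   .realGather 77 89 1, .realZip 78 .mul 0 77, .combine 79 .add 11 0 78,
   .realGather 80 89 3, .realZip 81 .mul 1 80, .combine 82 .add 12 2 81,
   .realZip 85 .sub 65 79, .realZip 86 .div 85 32, .realMap 90 .exp 86,
   .realZip 91 .sub 66 82, .realZip 92 .div 91 33, .realMap 93 .exp 92,
   .combine 94 .add 9 10 90, .combine 95 .add 94 12 93,
   .realGather 96 95 10, .realGather 97 95 12, .realZip 98 .sub 63 4]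

/-- Separate from `replyStep`, which reads these registers, so that both lists are
single-assignment. Adding zero acts as a copy; `newSums` and `storeSums` are split for the same
reason. -/
def replyUpdate : List Instr :=
  [.realZip 61 .div 90 96, .realZip 62 .div 93 97, .realZip 63 .add 98 9]

def reply : Prog :=
  .seq (block replySetup) (.loop 63 (.seq (block replyStep) (block replyUpdate)))

def currentSums : List Instr :=
  [.realZip 50 .add 40 10, .realZip 51 .add 41 11, .realZip 52 .add 42 12, .realZip 53 .add 43 9]

def extrapolatedSums : List Instr :=
  [.realZip 54 .add 60 60, .realZip 50 .add 40 54, .realZip 55 .add 61 61, .realZip 51 .add 41 55,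
   .realZip 56 .add 62 62, .realZip 52 .add 42 56, .realZip 53 .add 43 5]

def newSums : List Instr :=
  [.realZip 45 .add 40 60, .realZip 46 .add 41 61, .realZip 47 .add 42 62, .realZip 48 .add 43 4,
   .realZip 49 .sub 44 4]

def storeSums : List Instr :=
  [.realZip 40 .add 45 10, .realZip 41 .add 46 11, .realZip 42 .add 47 12, .realZip 43 .add 48 9,
   .realZip 44 .add 49 9]

/-- One round of the extragradient method. -/
def extragradientStep : Prog :=
  .seq (block currentSums) (.seq reply (.seq (block extrapolatedSums) (.seq reply
    (.seq (block newSums) (block storeSums)))))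

/-- The average point and the comparison of its largest violation with the accuracy. -/
def verdict : List Instr :=
  [.realGather 100 43 8, .realZip 101 .div 40 100,
   .realGather 102 101 1, .realZip 103 .mul 0 102, .combine 104 .add 11 0 103,
   .realZip 105 .sub 104 14, .combine 106 .max 9 10 105,
   .realGather 107 101 3, .realZip 108 .mul 1 107, .combine 109 .add 12 2 108,
   .realZip 110 .sub 15 109, .combine 111 .max 106 12 110,
   .realZip 112 .lt 2 111, .realZip 113 .sub 4 112]

def writeOutput : List Instr :=
  [.realZip 0 .add 113 9, .realZip 1 .add 101 10, .realZip 2 .add 41 11, .realZip 3 .add 42 12]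

def solver : Prog :=
  .seq (block indexSetup) (.seq (block setup) (.seq (.loop 44 extragradientStep)
    (.seq (block verdict) (block writeOutput))))

/-! ### Correctness of the program -/

section Correctness

variable {n p c : ℕ}

/-- The packing and the covering constraints as the rows of one matrix. -/
def constraintMatrix (P : Matrix (Fin p) (Fin n) ℝ) (C : Matrix (Fin c) (Fin n) ℝ) :
    Fin p ⊕ Fin c → Fin n → ℝ :=
  Sum.elim (fun i j => P i j) (fun i j => - C i j)

def rightHandSide (p c : ℕ) : Fin p ⊕ Fin c → ℝ := Sum.elim (fun _ => 1) (fun _ => -1)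

/-- Used twice: as the number of extragradient rounds (after rounding up), and in `1 + rounds`, the
threshold for `2 ^ k` in the alternating minimization. -/
noncomputable def rounds (p c : ℕ) (w ε : ℝ) : ℝ := 576 * (w * (1 + Real.log (p + c))) / ε

/-- The constant registers have been set up. -/
structure Ready (P : Matrix (Fin p) (Fin n) ℝ) (C : Matrix (Fin c) (Fin n) ℝ) (ε : ℝ)
    (lP : List (Fin p × Fin n)) (lC : List (Fin c × Fin n)) (w : ℝ) (s : State) : Prop where
  i0 : s.index 0 = lP.map fun e => (e.1 : ℕ)
  i1 : s.index 1 = lP.map fun e => (e.2 : ℕ)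
  i2 : s.index 2 = lC.map fun e => (e.1 : ℕ)
  i3 : s.index 3 = lC.map fun e => (e.2 : ℕ)
  i8 : s.index 8 = List.ofFn fun _ : Fin n => 0
  i10 : s.index 10 = List.ofFn fun _ : Fin p => 0
  i12 : s.index 12 = List.ofFn fun _ : Fin c => 0
  r0 : s.real 0 = lP.map fun e => P e.1 e.2
  r1 : s.real 1 = lC.map fun e => C e.1 e.2
  r2 : s.real 2 = [ε]
  r4 : s.real 4 = [1]
  r5 : s.real 5 = [2]
  r9 : s.real 9 = [0]
  r10 : s.real 10 = List.ofFn fun _ : Fin n => 0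
  r11 : s.real 11 = List.ofFn fun _ : Fin p => 0
  r12 : s.real 12 = List.ofFn fun _ : Fin c => 0
  r13 : s.real 13 = List.ofFn fun _ : Fin n => 1
  r14 : s.real 14 = List.ofFn fun _ : Fin p => 1
  r15 : s.real 15 = List.ofFn fun _ : Fin c => 1
  r30 : s.real 30 = [2 * Real.log (1 + rounds p c w ε)]
  r32 : s.real 32 = List.ofFn fun _ : Fin p => 12 * w
  r33 : s.real 33 = List.ofFn fun _ : Fin c => 12 * w
  r34 : s.real 34 = [1 / ((p : ℝ) + c)]
  r37 : s.real 37 = List.ofFn fun _ : Fin n => 24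
  r38 : s.real 38 = List.ofFn fun _ : Fin p => 24
  r39 : s.real 39 = List.ofFn fun _ : Fin c => 24

variable {P : Matrix (Fin p) (Fin n) ℝ} {C : Matrix (Fin c) (Fin n) ℝ} {ε w : ℝ}
  {lP : List (Fin p × Fin n)} {lC : List (Fin c × Fin n)} {s s' : State}

theorem Ready.keeps (h : Ready P C ε lP lC w s) {k : ℕ} (hk : 40 ≤ k) (hs : Keeps k s s') :
    Ready P C ε lP lC w s' := by
  obtain ⟨hr, hi⟩ := hs
  constructor
  · exact (congrFun hi _).trans h.i0
  · exact (congrFun hi _).trans h.i1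
  · exact (congrFun hi _).trans h.i2
  · exact (congrFun hi _).trans h.i3
  · exact (congrFun hi _).trans h.i8
  · exact (congrFun hi _).trans h.i10
  · exact (congrFun hi _).trans h.i12
  · exact (hr _ (by omega)).trans h.r0
  · exact (hr _ (by omega)).trans h.r1
  · exact (hr _ (by omega)).trans h.r2
  · exact (hr _ (by omega)).trans h.r4
  · exact (hr _ (by omega)).trans h.r5
  · exact (hr _ (by omega)).trans h.r9
  · exact (hr _ (by omega)).trans h.r10
  · exact (hr _ (by omega)).trans h.r11
  · exact (hr _ (by omega)).trans h.r12
  · exact (hr _ (by omega)).trans h.r13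
  · exact (hr _ (by omega)).trans h.r14
  · exact (hr _ (by omega)).trans h.r15
  · exact (hr _ (by omega)).trans h.r30
  · exact (hr _ (by omega)).trans h.r32
  · exact (hr _ (by omega)).trans h.r33
  · exact (hr _ (by omega)).trans h.r34
  · exact (hr _ (by omega)).trans h.r37
  · exact (hr _ (by omega)).trans h.r38
  · exact (hr _ (by omega)).trans h.r39

theorem sum_constraintMatrix_mul (X : Fin n → ℝ) (i : Fin p ⊕ Fin c) :
    ∑ j, constraintMatrix P C i j * X j =
      Sum.elim (fun i => ∑ j, P i j * X j) (fun i => - ∑ j, C i j * X j) i := by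
  cases i <;> simp [constraintMatrix]

theorem abs_constraintMatrix (hP : ∀ i j, 0 ≤ P i j) (hC : ∀ i j, 0 ≤ C i j) (i : Fin p ⊕ Fin c)
    (j : Fin n) : |constraintMatrix P C i j| = Sum.elim (fun i => P i j) (fun i => C i j) i := by
  cases i <;> simp [constraintMatrix, abs_of_nonneg, hP, hC]

/-- The linear term of the regularized problem for the sums `Y`. -/
noncomputable def pointTerm (P : Matrix (Fin p) (Fin n) ℝ) (C : Matrix (Fin c) (Fin n) ℝ)
    (Y : Fin p ⊕ Fin c → ℝ) (j : Fin n) : ℝ :=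
  -(∑ i, constraintMatrix P C i j * Y i) / 24

/-- The linear term of the regularized problem for the sums `X`. -/
noncomputable def weightTerm (P : Matrix (Fin p) (Fin n) ℝ) (C : Matrix (Fin c) (Fin n) ℝ)
    (t : ℝ) (X : Fin n → ℝ) (i : Fin p ⊕ Fin c) : ℝ :=
  (∑ j, constraintMatrix P C i j * X j - t * rightHandSide p c i) / 24

theorem holds_block {l : List Instr} (hl : singleAssignment l = true) (s : State) :
    l.Forall (Instr.Holds (runAll s l)) :=
  List.forall_iff_forall_mem.2 (holds_runAll hl s)

theorem column_product {m n : ℕ} {A : Matrix (Fin m) (Fin n) ℝ} {l : List (Fin m × Fin n)}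
    (hl : Lists A l) {base : Fin n → ℝ} {f : Fin m → ℝ} {v v₁ v₂ v₃ v₀ mat : List ℝ}
    {rows cols : List ℕ} (hmat : mat = l.map fun e => A e.1 e.2)
    (hrows : rows = l.map fun e => (e.1 : ℕ)) (hcols : cols = l.map fun e => (e.2 : ℕ))
    (hv : v = List.ofFn f) (hv₀ : v₀ = List.ofFn base) (h₁ : v₁ = rows.map fun k => v.getD k 0)
    (h₂ : v₂ = List.zipWith BinaryOp.mul.eval mat v₁) (h₃ : v₃ = combineByKey .add v₀ cols v₂) :
    v₃ = List.ofFn fun j => base j + ∑ i, A i j * f i := by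
  rw [hrows, hv, map_getD_ofFn] at h₁
  rw [hmat, h₁, zipWith_map_map] at h₂
  rw [h₃, h₂, hcols, hv₀]
  exact combineByKey_column hl base f

theorem row_product {m n : ℕ} {A : Matrix (Fin m) (Fin n) ℝ} {l : List (Fin m × Fin n)}
    (hl : Lists A l) {base : Fin m → ℝ} {f : Fin n → ℝ} {v v₁ v₂ v₃ v₀ mat : List ℝ}
    {rows cols : List ℕ} (hmat : mat = l.map fun e => A e.1 e.2)
    (hrows : rows = l.map fun e => (e.1 : ℕ)) (hcols : cols = l.map fun e => (e.2 : ℕ))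
    (hv : v = List.ofFn f) (hv₀ : v₀ = List.ofFn base) (h₁ : v₁ = cols.map fun k => v.getD k 0)
    (h₂ : v₂ = List.zipWith BinaryOp.mul.eval mat v₁) (h₃ : v₃ = combineByKey .add v₀ rows v₂) :
    v₃ = List.ofFn fun i => base i + ∑ j, A i j * f j := by
  rw [hcols, hv, map_getD_ofFn] at h₁
  rw [hmat, h₁, zipWith_map_map] at h₂
  rw [h₃, h₂, hrows, hv₀]
  exact combineByKey_row hl base f

theorem runAll_replySetup (hR : Ready P C ε lP lC w s) (hlP : Lists P lP) (hlC : Lists C lC)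
    {X : Fin n → ℝ} {Y : Fin p ⊕ Fin c → ℝ} {t : ℝ} (hX : s.real 50 = List.ofFn X)
    (hY : s.real 51 = List.ofFn fun i => Y (.inl i))
    (hZ : s.real 52 = List.ofFn fun i => Y (.inr i)) (ht : s.real 53 = [t])
    (hs' : s' = runAll s replySetup) :
    Ready P C ε lP lC w s' ∧
    s'.real 64 = List.ofFn (pointTerm P C Y) ∧
    (s'.real 65 = List.ofFn fun i => weightTerm P C t X (.inl i)) ∧
    (s'.real 66 = List.ofFn fun i => weightTerm P C t X (.inr i)) ∧
    (s'.real 60 = List.ofFn fun _ : Fin n => 0) ∧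
    (s'.real 61 = List.ofFn fun _ : Fin p => 1 / ((p : ℝ) + c)) ∧
    (s'.real 62 = List.ofFn fun _ : Fin c => 1 / ((p : ℝ) + c)) ∧
    s'.real 63 = [2 * Real.log (1 + rounds p c w ε)] := by
  have hK : Keeps 60 s s' := hs' ▸ runAll_keeps (by decide)
  have H := holds_block (l := replySetup) (by decide) s
  rw [← hs'] at H
  have hR' := hR.keeps (by norm_num) hK
  rw [← hK.1 _ (by norm_num)] at hX hY hZ ht
  clear hs' hK hR
  simp only [replySetup, List.Forall, Instr.Holds] at H
  obtain ⟨h70, h71, h72, h73, h74, h75, h76, h64, h77, h78, h79, h80, h81, h82, h83, h84, h85, h65,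
    h86, h66, h60, h61, h62, h63⟩ := H
  have c72 := column_product hlP hR'.r0 hR'.i0 hR'.i1 hY hR'.r10 h70 h71 h72
  have c75 := column_product hlC hR'.r1 hR'.i2 hR'.i3 hZ hR'.r10 h73 h74 h75
  have c79 := row_product hlP hR'.r0 hR'.i0 hR'.i1 hX hR'.r11 h77 h78 h79
  have c82 := row_product hlC hR'.r1 hR'.i2 hR'.i3 hX hR'.r12 h80 h81 h82
  rw [c75, c72, zipWith_ofFn] at h76
  rw [h76, hR'.r37, zipWith_ofFn] at h64
  rw [ht, hR'.i10, map_getD_zero] at h83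
  rw [ht, hR'.i12, map_getD_zero] at h84
  rw [c79, h83, zipWith_ofFn] at h85
  rw [h85, hR'.r38, zipWith_ofFn] at h65
  rw [c82, h84, zipWith_ofFn] at h86
  rw [h86, hR'.r39, zipWith_ofFn] at h66
  rw [hR'.r9, hR'.i8, map_getD_zero] at h60
  rw [hR'.r34, hR'.i10, map_getD_zero] at h61
  rw [hR'.r34, hR'.i12, map_getD_zero] at h62
  rw [hR'.r30, hR'.r9] at h63
  refine ⟨hR', h64.trans (congrArg _ (funext fun j => ?_)),
    h65.trans (congrArg _ (funext fun i => ?_)), h66.trans (congrArg _ (funext fun i => ?_)),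
    h60, h61, h62, h63.trans ?_⟩
  · simp only [BinaryOp.eval, pointTerm, constraintMatrix, Fintype.sum_sum_type, Sum.elim_inl,
      Sum.elim_inr, neg_mul, sum_neg_distrib, zero_add, neg_add_rev, neg_neg, sub_eq_add_neg]
  · simp [BinaryOp.eval, weightTerm, constraintMatrix, rightHandSide]
  · simp [BinaryOp.eval, weightTerm, constraintMatrix, rightHandSide, sub_eq_add_neg, add_comm]
  · simp [BinaryOp.eval]

/-- First-order optimality of the clamped stationary point `g / 2d` of `d s² - g s`. For `d = 0` the
convention `g / 0 = 0` gives the point `0`, which is optimal because then `g = 0`. -/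
theorem clamp_isMin {d g s : ℝ} (hd : 0 ≤ d) (hg : d = 0 → g = 0) (h0 : 0 ≤ s) (h1 : s ≤ 1) :
    g * (s - max (min (g / (d + d)) 1) 0) ≤
      2 * d * max (min (g / (d + d)) 1) 0 * (s - max (min (g / (d + d)) 1) 0) := by
  rcases hd.eq_or_lt with rfl | hd
  · simp [hg rfl]
  have hg' : g = 2 * d * (g / (d + d)) := by field_simp; ring
  set q := g / (d + d)
  rcases le_total q 1 with hq | hq
  · rcases le_total q 0 with hq' | hq'
    · rw [min_eq_left hq, max_eq_right hq', hg']
      nlinarith [mul_nonneg (mul_nonneg hd.le (neg_nonneg.2 hq')) h0]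
    · rw [min_eq_left hq, max_eq_left hq', ← hg']
  · rw [min_eq_right hq, max_eq_left zero_le_one, hg']
    nlinarith [mul_nonneg (mul_nonneg hd.le (sub_nonneg.2 hq)) (sub_nonneg.2 h1)]

/-- The minimizer over the box that the machine computes. -/
noncomputable def boxReply (P : Matrix (Fin p) (Fin n) ℝ) (C : Matrix (Fin c) (Fin n) ℝ)
    (g : Fin n → ℝ) (y : Fin p ⊕ Fin c → ℝ) (j : Fin n) : ℝ :=
  let d := ∑ i, |constraintMatrix P C i j| * y i
  max (min (g j / (d + d)) 1) 0

/-- The weights are positive, so a zero quadratic coefficient means a zero column of the matrix, and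
then the linear term vanishes too. -/
theorem isBoxMin_boxReply {Y y : Fin p ⊕ Fin c → ℝ} (hy : ∀ i, 0 < y i) :
    IsBoxMin (constraintMatrix P C) (pointTerm P C Y) y
      (boxReply P C (pointTerm P C Y) y) := by
  intro j
  refine ⟨⟨le_max_right _ _, max_le (min_le_right _ _) zero_le_one⟩, fun s h0 h1 => ?_⟩
  have hnn : ∀ i ∈ univ, 0 ≤ |constraintMatrix P C i j| * y i := fun i _ =>
    mul_nonneg (abs_nonneg _) (hy i).le
  refine clamp_isMin (sum_nonneg hnn) (fun h => ?_) h0 h1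
  rw [sum_eq_zero_iff_of_nonneg hnn] at h
  have : ∀ i, constraintMatrix P C i j = 0 := fun i => by
    simpa [(hy i).ne'] using h i (mem_univ i)
  simp [pointTerm, this]

theorem runAll_replyStep (hP : ∀ i j, 0 ≤ P i j) (hC : ∀ i j, 0 ≤ C i j)
    (hR : Ready P C ε lP lC w s) (hlP : Lists P lP) (hlC : Lists C lC)
    {g : Fin n → ℝ} {h y : Fin p ⊕ Fin c → ℝ} {v : ℝ} (e64 : s.real 64 = List.ofFn g)
    (e65 : s.real 65 = List.ofFn fun i => h (.inl i))
    (e66 : s.real 66 = List.ofFn fun i => h (.inr i))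
    (e61 : s.real 61 = List.ofFn fun i => y (.inl i))
    (e62 : s.real 62 = List.ofFn fun i => y (.inr i))
    (e63 : s.real 63 = [v])
    (hs' : s' = runAll (runAll s replyStep) replyUpdate) :
    let x := boxReply P C g y
    let y' := expWeights (exponent (constraintMatrix P C) (12 * w) h x)
    Ready P C ε lP lC w s' ∧
    s'.real 64 = List.ofFn g ∧
    (s'.real 65 = List.ofFn fun i => h (.inl i)) ∧
    (s'.real 66 = List.ofFn fun i => h (.inr i)) ∧
    s'.real 60 = List.ofFn x ∧
    (s'.real 61 = List.ofFn fun i => y' (.inl i)) ∧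
    (s'.real 62 = List.ofFn fun i => y' (.inr i)) ∧
    s'.real 63 = [v - 1] := by
  intro x y'
  obtain ⟨s₁, hs₁⟩ : ∃ s₁, s₁ = runAll s replyStep := ⟨_, rfl⟩
  rw [← hs₁] at hs'
  have hK : Keeps 60 s s₁ := hs₁ ▸ runAll_keeps (by decide)
  have H := holds_block (l := replyStep) (by decide) s
  rw [← hs₁] at H
  have hR₁ := hR.keeps (by norm_num) hK
  -- `Keeps 60` says nothing about these registers, but `replyStep` does not write them.
  have f : ∀ r ∈ [61, 62, 63, 64, 65, 66], s₁.real r = s.real r := by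
    intro r hr
    rw [hs₁]
    refine runAll_real_of_ne ?_
    revert r
    decide
  rw [← f _ (by decide)] at e64 e65 e66 e61 e62 e63
  have hK' : Keeps 60 s₁ s' := hs' ▸ runAll_keeps (by decide)
  have hR' := hR₁.keeps (by norm_num) hK'
  have H' := holds_block (l := replyUpdate) (by decide) s₁
  rw [← hs'] at H'
  have f' : ∀ r ∈ [60, 64, 65, 66, 90, 93, 96, 97, 98], s'.real r = s₁.real r := by
    intro r hr
    rw [hs']
    refine runAll_real_of_ne ?_
    revert r
    decide
  clear hs' hs₁ hR hK hK' f
  simp only [replyStep, List.Forall, Instr.Holds] at H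
  simp only [replyUpdate, List.Forall, Instr.Holds] at H'
  obtain ⟨h70, h71, h72, h73, h74, h75, h76, h87, h88, h60, h89, h77, h78, h79, h80, h81, h82, h85,
    h86, h90, h91, h92, h93, h94, h95, h96, h97, h98⟩ := H
  obtain ⟨k61, k62, k63⟩ := H'
  have c72 := column_product hlP hR₁.r0 hR₁.i0 hR₁.i1 e61 hR₁.r10 h70 h71 h72
  have c75 := column_product hlC hR₁.r1 hR₁.i2 hR₁.i3 e62 c72 h73 h74 h75
  rw [c75, zipWith_ofFn] at h76
  rw [e64, h76, zipWith_ofFn] at h87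
  rw [h87, hR₁.r13, zipWith_ofFn] at h88
  rw [h88, hR₁.r10, zipWith_ofFn] at h60
  replace h60 : s₁.real 60 = List.ofFn x := by
    rw [h60]
    refine congrArg _ (funext fun j => ?_)
    simp only [BinaryOp.eval, x, boxReply, abs_constraintMatrix hP hC, Fintype.sum_sum_type,
      Sum.elim_inl, Sum.elim_inr, zero_add]
  rw [h60, zipWith_ofFn] at h89
  have c79 := row_product hlP hR₁.r0 hR₁.i0 hR₁.i1 h89 hR₁.r11 h77 h78 h79
  have c82 := row_product hlC hR₁.r1 hR₁.i2 hR₁.i3 h89 hR₁.r12 h80 h81 h82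
  rw [e65, c79, zipWith_ofFn] at h85
  rw [h85, hR₁.r32, zipWith_ofFn] at h86
  rw [e66, c82, zipWith_ofFn] at h91
  rw [h91, hR₁.r33, zipWith_ofFn] at h92
  set q := exponent (constraintMatrix P C) (12 * w) h x
  replace h90 : s₁.real 90 = List.ofFn fun i => Real.exp (q (.inl i)) := by
    rw [h90, h86, List.map_ofFn]
    refine congrArg _ (funext fun i => ?_)
    simp only [Function.comp, UnaryOp.eval, BinaryOp.eval, q, exponent,
      abs_constraintMatrix hP hC, Sum.elim_inl, zero_add, pow_two]
  replace h93 : s₁.real 93 = List.ofFn fun i => Real.exp (q (.inr i)) := by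
    rw [h93, h92, List.map_ofFn]
    refine congrArg _ (funext fun i => ?_)
    simp only [Function.comp, UnaryOp.eval, BinaryOp.eval, q, exponent,
      abs_constraintMatrix hP hC, Sum.elim_inr, zero_add, pow_two]
  rw [hR₁.r9, hR₁.i10, h90, combineByKey_sum, zero_add] at h94
  rw [h94, hR₁.i12, h93, combineByKey_sum, ← Fintype.sum_sum_type (fun i => Real.exp (q i))] at h95
  rw [h95, hR₁.i10, map_getD_zero] at h96
  rw [h95, hR₁.i12, map_getD_zero] at h97
  rw [e63, hR₁.r4] at h98
  refine ⟨hR', (f' _ (by decide)).trans e64, (f' _ (by decide)).trans e65,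
    (f' _ (by decide)).trans e66, (f' _ (by decide)).trans h60, ?_, ?_, ?_⟩
  · rw [k61, f' 90 (by decide), f' 96 (by decide), h90, h96, zipWith_ofFn]
    rfl
  · rw [k62, f' 93 (by decide), f' 97 (by decide), h93, h97, zipWith_ofFn]
    rfl
  · rw [k63, f' 98 (by decide), h98, hR'.r9]
    simp [BinaryOp.eval]

variable {B : ℕ}

theorem nonempty_constraints (hm : 1 ≤ p + c) : Nonempty (Fin p ⊕ Fin c) :=
  Fintype.card_pos_iff.1 (by rw [Fintype.card_sum, Fintype.card_fin, Fintype.card_fin]; exact hm)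

theorem rounds_pos (hw : 0 < w) (hε : 0 < ε) (hm : 1 ≤ p + c) : 0 < rounds p c w ε := by
  have h : (1 : ℝ) ≤ p + c := by exact_mod_cast hm
  have := Real.log_nonneg h
  unfold rounds
  positivity

/-- The factor `2` suffices because `log 2 > 1/2`. -/
theorem le_two_pow_of_log_le {a : ℝ} (ha : 1 ≤ a) {k : ℕ} (hk : 2 * Real.log a ≤ k) :
    a ≤ 2 ^ k := by
  rw [← Real.log_le_log_iff (by linarith) (by positivity), Real.log_pow]
  have h1 := Real.log_nonneg ha
  have h2 := Real.log_two_gt_d9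
  nlinarith

noncomputable def replyLength (p c : ℕ) (w ε : ℝ) : ℕ :=
  24 + (⌈2 * Real.log (1 + rounds p c w ε)⌉₊ * 32 + 1)

theorem attains_reply (hB : 1 ≤ B) (hs : s.Bounded B) (hP : ∀ i j, 0 ≤ P i j)
    (hC : ∀ i j, 0 ≤ C i j) (hε : 0 < ε) (hw : 0 < w) (hm : 1 ≤ p + c)
    (hA : ∀ i, ∑ j, |constraintMatrix P C i j| ≤ w) (hlP : Lists P lP) (hlC : Lists C lC)
    (hR : Ready P C ε lP lC w s)
    {X : Fin n → ℝ} {Y : Fin p ⊕ Fin c → ℝ} {t : ℝ} (hX : s.real 50 = List.ofFn X)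
    (hY : s.real 51 = List.ofFn fun i => Y (.inl i))
    (hZ : s.real 52 = List.ofFn fun i => Y (.inr i)) (ht : s.real 53 = [t]) :
    Attains B reply s (replyLength p c w ε) fun s' => Keeps 60 s s' ∧
      ∃ x y, IsReply (constraintMatrix P C) (rightHandSide p c) w ε t X Y x y ∧
        s'.real 60 = List.ofFn x ∧ (s'.real 61 = List.ofFn fun i => y (.inl i)) ∧
        s'.real 62 = List.ofFn fun i => y (.inr i) := by
  have : Nonempty (Fin p ⊕ Fin c) := nonempty_constraints hm
  have hcard : (Fintype.card (Fin p ⊕ Fin c) : ℝ) = p + c := by simp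
  set g := pointTerm P C Y
  set h := weightTerm P C t X
  set v := 2 * Real.log (1 + rounds p c w ε)
  let Inv : ℕ → State → Prop := fun k s => Ready P C ε lP lC w s ∧ ∃ x y,
    AlternatingInv (constraintMatrix P C) w g h
      (fun _ => 1 / (Fintype.card (Fin p ⊕ Fin c) : ℝ)) k x y ∧
    s.real 64 = List.ofFn g ∧ (s.real 65 = List.ofFn fun i => h (.inl i)) ∧
    (s.real 66 = List.ofFn fun i => h (.inr i)) ∧ s.real 60 = List.ofFn x ∧
    (s.real 61 = List.ofFn fun i => y (.inl i)) ∧ (s.real 62 = List.ofFn fun i => y (.inr i)) ∧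
    s.real 63 = [v - k]
  have hloop : ∀ s : State, s.Bounded B → Inv 0 s →
      Attains B (.loop 63 (.seq (block replyStep) (block replyUpdate))) s
        (⌈v⌉₊ * (28 + 3 + 1) + 1) fun s' => ∃ k : ℕ, v ≤ k ∧ Inv k s' := by
    intro s hs h0
    refine Attains.loop ?_ ?_ hs h0
    · rintro k s ⟨-, x, y, -, -, -, -, -, -, -, h63⟩
      rw [h63]
      rfl
    · rintro k s hs ⟨hR, x, y, hI, h64, h65, h66, h60, h61, h62, h63⟩
      refine Attains.seq (Attains.block hB hs (by decide) (by decide)) fun s₁ hs₁ e₁ =>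
        (Attains.block hB hs₁ (by decide) (by decide)).mono le_rfl fun s₂ e₂ => ?_
      obtain ⟨hR', k64, k65, k66, k60, k61, k62, k63⟩ :=
        runAll_replyStep hP hC hR hlP hlC h64 h65 h66 h61 h62 h63 (e₁ ▸ e₂)
      refine ⟨hR', _, _, hI.step hw hA (isBoxMin_boxReply hI.pos), k64, k65, k66, k60, k61, k62, ?_⟩
      rw [k63]
      push_cast
      rw [sub_sub]
  refine ((Attains.seq (n := 24) (Attains.block hB hs (by decide) (by decide)) fun s₁ hs₁ e₁ =>
    hloop s₁ hs₁ ?_).keeps (k := 60) (by decide)).mono le_rfl ?_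
  · obtain ⟨hR', k64, k65, k66, k60, k61, k62, k63⟩ :=
      runAll_replySetup hR hlP hlC hX hY hZ ht e₁
    refine ⟨hR', _, _, AlternatingInv.init _ w g h, k64, k65, k66, k60, ?_, ?_, ?_⟩
    · rw [k61, hcard]
    · rw [k62, hcard]
    · rw [k63]
      simp [v]
  · rintro s' ⟨⟨k, hk, -, x, y, hI, -, -, -, k60, k61, k62, -⟩, hK⟩
    refine ⟨hK, x, y, ⟨hI.inDomain, fun x' y' hu => ?_⟩, k60, k61, k62⟩
    have hpos := rounds_pos hw hε hm
    have h1 := le_two_pow_of_log_le (by linarith) hk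
    have h2 := hI.objective_le hw hε hu (by
      rw [hcard, mul_assoc 576]
      exact h1)
    rw [regularizer_sub_regret, regularizer_sub_regret]
    simp only [g, h] at h2
    have h3 : ∀ a b d e : ℝ, a ≤ b + e → a - d ≤ b - d + e := fun a b d e h => by linarith
    exact h3 _ _ _ _ h2

/-- The sums after `k` rounds are stored. -/
def SumsStored (P : Matrix (Fin p) (Fin n) ℝ) (C : Matrix (Fin c) (Fin n) ℝ) (ε w : ℝ)
    (lP : List (Fin p × Fin n)) (lC : List (Fin c × Fin n)) (k : ℕ) (s : State) : Prop :=
  Ready P C ε lP lC w s ∧ ∃ X Y,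
    ExtragradientInv (constraintMatrix P C) (rightHandSide p c) w ε k X Y ∧
    s.real 40 = List.ofFn X ∧ (s.real 41 = List.ofFn fun i => Y (.inl i)) ∧
    (s.real 42 = List.ofFn fun i => Y (.inr i)) ∧ s.real 43 = [(k : ℝ)] ∧
    s.real 44 = [rounds p c w ε - k]

theorem attains_extragradientStep (hB : 1 ≤ B) (hs : s.Bounded B) (hP : ∀ i j, 0 ≤ P i j)
    (hC : ∀ i j, 0 ≤ C i j) (hε : 0 < ε) (hw : 0 < w) (hm : 1 ≤ p + c)
    (hA : ∀ i, ∑ j, |constraintMatrix P C i j| ≤ w) (hlP : Lists P lP) (hlC : Lists C lC) {k : ℕ}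
    (h : SumsStored P C ε w lP lC k s) :
    Attains B extragradientStep s (21 + 2 * replyLength p c w ε)
      (SumsStored P C ε w lP lC (k + 1)) := by
  obtain ⟨hR, X, Y, hI, h40, h41, h42, h43, h44⟩ := h
  have hn : 21 + 2 * replyLength p c w ε =
      4 + (replyLength p c w ε + (7 + (replyLength p c w ε + (5 + 5)))) := by ring
  rw [hn]
  refine (Attains.block hB hs (l := currentSums) (by decide) (by decide)).seq fun s₁ hs₁ e₁ => ?_
  have K₁ : Keeps 50 s s₁ := e₁ ▸ runAll_keeps (by decide)
  have H₁ := holds_block (l := currentSums) (by decide) s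
  rw [← e₁] at H₁
  simp only [currentSums, List.Forall, Instr.Holds] at H₁
  have hR₁ := hR.keeps (by norm_num) K₁
  rw [← K₁.1 _ (by norm_num)] at h40 h41 h42 h43 h44
  obtain ⟨h50, h51, h52, h53⟩ := H₁
  rw [h40, hR₁.r10, zipWith_ofFn] at h50
  rw [h41, hR₁.r11, zipWith_ofFn] at h51
  rw [h42, hR₁.r12, zipWith_ofFn] at h52
  rw [h43, hR₁.r9] at h53
  simp only [BinaryOp.eval, add_zero, List.zipWith_cons_cons, List.zipWith_nil_left]
    at h50 h51 h52 h53
  refine (attains_reply hB hs₁ hP hC hε hw hm hA hlP hlC hR₁ h50 h51 h52 h53).seq ?_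
  rintro s₂ hs₂ ⟨K₂, xp, yp, hp, h60, h61, h62⟩
  have hR₂ := hR₁.keeps (by norm_num) K₂
  rw [← K₂.1 _ (by norm_num)] at h40 h41 h42 h43 h44
  refine (Attains.block hB hs₂ (l := extrapolatedSums) (by decide) (by decide)).seq
    fun s₃ hs₃ e₃ => ?_
  have K₃ : Keeps 50 s₂ s₃ := e₃ ▸ runAll_keeps (by decide)
  have H₃ := holds_block (l := extrapolatedSums) (by decide) s₂
  have f₃ : ∀ r ∈ [60, 61, 62], s₃.real r = s₂.real r := by
    intro r hr
    rw [e₃]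
    refine runAll_real_of_ne ?_
    revert r
    decide
  rw [← e₃] at H₃
  simp only [extrapolatedSums, List.Forall, Instr.Holds] at H₃
  have hR₃ := hR₂.keeps (by norm_num) K₃
  rw [← K₃.1 _ (by norm_num)] at h40 h41 h42 h43 h44
  rw [← f₃ _ (by decide)] at h60 h61 h62
  obtain ⟨h54, k50, h55, k51, h56, k52, k53⟩ := H₃
  rw [h60, zipWith_ofFn] at h54
  rw [h61, zipWith_ofFn] at h55
  rw [h62, zipWith_ofFn] at h56
  rw [h40, h54, zipWith_ofFn] at k50
  rw [h41, h55, zipWith_ofFn] at k51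
  rw [h42, h56, zipWith_ofFn] at k52
  rw [h43, hR₃.r5] at k53
  simp only [BinaryOp.eval, ← two_mul, List.zipWith_cons_cons, List.zipWith_nil_left]
    at k50 k51 k52 k53
  refine (attains_reply hB hs₃ hP hC hε hw hm hA hlP hlC hR₃
    (Y := fun i => Y i + 2 * yp i) k50 k51 k52 k53).seq ?_
  rintro s₄ hs₄ ⟨K₄, xq, yq, hq, k60, k61, k62⟩
  have hR₄ := hR₃.keeps (by norm_num) K₄
  rw [← K₄.1 _ (by norm_num)] at h40 h41 h42 h43 h44
  have hI' := hI.step hA hp hq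
  refine (Attains.block hB hs₄ (l := newSums) (by decide) (by decide)).seq fun s₅ hs₅ e₅ =>
    (Attains.block hB hs₅ (l := storeSums) (by decide) (by decide)).mono le_rfl fun s₆ e₆ => ?_
  have K₅ : Keeps 45 s₄ s₅ := e₅ ▸ runAll_keeps (by decide)
  have H₅ := holds_block (l := newSums) (by decide) s₄
  have f₅ : ∀ r ∈ [60, 61, 62], s₅.real r = s₄.real r := by
    intro r hr
    rw [e₅]
    refine runAll_real_of_ne ?_
    revert r
    decide
  rw [← e₅] at H₅
  simp only [newSums, List.Forall, Instr.Holds] at H₅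
  have hR₅ := hR₄.keeps (by norm_num) K₅
  rw [← K₅.1 _ (by norm_num)] at h40 h41 h42 h43 h44
  rw [← f₅ _ (by decide)] at k60 k61 k62
  obtain ⟨h45, h46, h47, h48, h49⟩ := H₅
  have K₆ : Keeps 40 s₅ s₆ := e₆ ▸ runAll_keeps (by decide)
  have H₆ := holds_block (l := storeSums) (by decide) s₅
  have f₆ : ∀ r ∈ [45, 46, 47, 48, 49], s₆.real r = s₅.real r := by
    intro r hr
    rw [e₆]
    refine runAll_real_of_ne ?_
    revert r
    decide
  rw [← e₆] at H₆
  simp only [storeSums, List.Forall, Instr.Holds] at H₆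
  have hR₆ := hR₅.keeps (by norm_num) K₆
  obtain ⟨l40, l41, l42, l43, l44⟩ := H₆
  rw [f₆ 45 (by decide), h45, hR₆.r10, h40, k60, zipWith_ofFn, zipWith_ofFn] at l40
  rw [f₆ 46 (by decide), h46, hR₆.r11, h41, k61, zipWith_ofFn, zipWith_ofFn] at l41
  rw [f₆ 47 (by decide), h47, hR₆.r12, h42, k62, zipWith_ofFn, zipWith_ofFn] at l42
  rw [f₆ 48 (by decide), h48, hR₆.r9, h43, hR₅.r4] at l43
  rw [f₆ 49 (by decide), h49, hR₆.r9, h44, hR₅.r4] at l44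
  simp only [BinaryOp.eval, add_zero, List.zipWith_cons_cons, List.zipWith_nil_left]
    at l40 l41 l42 l43 l44
  refine ⟨hR₆, _, _, hI', l40, l41, l42, ?_, ?_⟩
  · rw [l43]
    push_cast
    rfl
  · rw [l44]
    push_cast
    rw [sub_sub]

/-! ### The initial phase -/

theorem length_eq_nnz {m n : ℕ} {A : Matrix (Fin m) (Fin n) ℝ} {l : List (Fin m × Fin n)}
    (hl : Lists A l) : l.length = nnz A := by
  rw [nnz, ← List.toFinset_card_of_nodup hl.1, ← Set.ncard_coe_finset]
  congr 1
  ext e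
  simp [hl.2]

theorem sum_row_le_rowWidth {m n : ℕ} {A : Matrix (Fin m) (Fin n) ℝ} (hA : ∀ i j, A i j ≤ 1)
    (i : Fin m) : ∑ j, A i j ≤ rowWidth A := by
  have h1 : ∑ j, A i j ≤ ∑ j, if A i j ≠ 0 then 1 else 0 := by
    refine sum_le_sum fun j _ => ?_
    split_ifs with h
    · exact hA i j
    · exact (not_not.1 h).le
  rw [sum_boole] at h1
  have h2 : {j : Fin n | A i j ≠ 0}.ncard ≤ rowWidth A :=
    le_sup (f := fun i : Fin m => {j : Fin n | A i j ≠ 0}.ncard) (mem_univ i)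
  have h3 : {j : Fin n | A i j ≠ 0}.ncard = (univ.filter fun j => A i j ≠ 0).card := by
    rw [← Set.ncard_coe_finset]
    simp
  rw [h3] at h2
  exact h1.trans (by exact_mod_cast h2)

theorem one_le_rowWidth {m n : ℕ} {A : Matrix (Fin m) (Fin n) ℝ} (h : 0 < nnz A) :
    1 ≤ rowWidth A := by
  obtain ⟨⟨i, j⟩, hij⟩ := (Set.ncard_pos (Set.toFinite _)).1 h
  refine le_trans ?_ (le_sup (f := fun i : Fin m => {j : Fin n | A i j ≠ 0}.ncard) (mem_univ i))
  exact (Set.ncard_pos (Set.toFinite _)).2 ⟨j, hij⟩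

theorem one_le_width (h : 0 < nnz P + nnz C) : 1 ≤ width P C := by
  rcases Nat.eq_zero_or_pos (nnz P) with h0 | h0
  · exact (one_le_rowWidth (by omega)).trans (le_max_right _ _)
  · exact (one_le_rowWidth h0).trans (le_max_left _ _)

theorem one_le_add_of_nnz_pos (h : 0 < nnz P + nnz C) : 1 ≤ p + c := by
  by_contra hc
  obtain ⟨rfl, rfl⟩ : p = 0 ∧ c = 0 := by omega
  simp [nnz, Set.eq_empty_of_isEmpty] at h

theorem bounded_input (hlP : Lists P lP) (hlC : Lists C lC) (hB : 1 ≤ B)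
    (hN : nnz P + nnz C ≤ B) : (input P C ε lP lC).Bounded B := by
  have h1 := length_eq_nnz hlP
  have h2 := length_eq_nnz hlC
  intro r
  constructor
  · simp only [input]
    split <;> simp <;> omega
  · simp only [input]
    split <;> simp <;> omega

theorem attains_indexSetup (hs : (input P C ε lP lC).Bounded B) (hB : 1 ≤ B) (hn : n ≤ B)
    (hp : p ≤ B) (hc : c ≤ B) :
    Attains B (block indexSetup) (input P C ε lP lC) 3 fun s =>
      s = runAll (input P C ε lP lC) indexSetup := by
  refine (Attains.instr hB hs (i := .iota 7 4) ?_).seq fun s₁ hs₁ e₁ =>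
    (Attains.instr hB hs₁ (i := .iota 9 5) ?_).seq fun s₂ hs₂ e₂ =>
    (Attains.instr hB hs₂ (i := .iota 11 6) ?_).mono le_rfl fun s₃ e₃ => ?_
  · simpa [Instr.Fits, input] using hn
  · simpa [Instr.Fits, input, e₁, Instr.run, State.setIndex] using hp
  · simpa [Instr.Fits, input, e₁, e₂, Instr.run, State.setIndex] using hc
  · rw [e₃, e₂, e₁]
    rfl

theorem rowSum_eq {m n : ℕ} {A : Matrix (Fin m) (Fin n) ℝ} {l : List (Fin m × Fin n)}
    (hl : Lists A l) {v v₀ mat : List ℝ} {rows : List ℕ} (hmat : mat = l.map fun e => A e.1 e.2)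
    (hrows : rows = l.map fun e => (e.1 : ℕ)) (hv₀ : v₀ = List.ofFn fun _ : Fin m => 0)
    (h : v = combineByKey .add v₀ rows mat) : v = List.ofFn fun i => ∑ j, A i j := by
  have := combineByKey_row hl (fun _ => 0) (fun _ => 1)
  simp only [mul_one, zero_add] at this
  rw [h, hv₀, hrows, hmat]
  exact this

theorem sub_self_range (m : ℕ) :
    List.zipWith IndexOp.sub.eval (List.range m) (List.range m) =
      List.ofFn fun _ : Fin m => 0 := by
  rw [range_eq_ofFn, zipWith_ofFn]
  simp [IndexOp.eval]

/-- The program uses the largest row sum, raised to at least `1`, in place of the width. Since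
entries are at most `1` and some entry is nonzero, this number is at most the width; the floor `1`
keeps the divisors `12 w` positive. -/
theorem runAll_setup (hP : ∀ i j, 0 ≤ P i j ∧ P i j ≤ 1) (hC : ∀ i j, 0 ≤ C i j ∧ C i j ≤ 1)
    (hlP : Lists P lP) (hlC : Lists C lC) (hN : 0 < nnz P + nnz C)
    (hs' : s' = runAll (runAll (input P C ε lP lC) indexSetup) setup) :
    ∃ w : ℝ, 1 ≤ w ∧ w ≤ width P C ∧ (∀ i, ∑ j, |constraintMatrix P C i j| ≤ w) ∧
      SumsStored P C ε w lP lC 0 s' := by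
  have hm : 1 ≤ p + c := one_le_add_of_nnz_pos hN
  have : Nonempty (Fin p ⊕ Fin c) := nonempty_constraints hm
  obtain ⟨s, hs⟩ : ∃ s, s = runAll (input P C ε lP lC) indexSetup := ⟨_, rfl⟩
  rw [← hs] at hs'
  have i0 : s.index 0 = lP.map fun e => (e.1 : ℕ) := by rw [hs]; rfl
  have i1 : s.index 1 = lP.map fun e => (e.2 : ℕ) := by rw [hs]; rfl
  have i2 : s.index 2 = lC.map fun e => (e.1 : ℕ) := by rw [hs]; rfl
  have i3 : s.index 3 = lC.map fun e => (e.2 : ℕ) := by rw [hs]; rfl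
  have i5 : s.index 5 = [p] := by rw [hs]; rfl
  have i6 : s.index 6 = [c] := by rw [hs]; rfl
  have i7 : s.index 7 = List.range n := by rw [hs]; rfl
  have i9 : s.index 9 = List.range p := by rw [hs]; rfl
  have i11 : s.index 11 = List.range c := by rw [hs]; rfl
  have r0 : s.real 0 = lP.map fun e => P e.1 e.2 := by rw [hs]; rfl
  have r1 : s.real 1 = lC.map fun e => C e.1 e.2 := by rw [hs]; rfl
  have r2 : s.real 2 = [ε] := by rw [hs]; rfl
  have fi : ∀ r ∈ [0, 1, 2, 3, 5, 6, 7, 9, 11], s'.index r = s.index r := by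
    intro r hr
    rw [hs']
    refine runAll_index_of_ne ?_
    revert r
    decide
  have fr : ∀ r ∈ [0, 1, 2], s'.real r = s.real r := by
    intro r hr
    rw [hs']
    refine runAll_real_of_ne ?_
    revert r
    decide
  have H := holds_block (l := setup) (by decide) s
  rw [← hs'] at H
  rw [← fi _ (by decide)] at i0 i1 i2 i3 i5 i6 i7 i9 i11
  rw [← fr _ (by decide)] at r0 r1 r2
  clear fi fr hs' hs
  simp only [setup, List.Forall, Instr.Holds] at H
  obtain ⟨i8, i10, i12, r9, r4, r5, r6, r7, r8, r10, r11, r12, r13, r14, r15, r16, r17, r18, r19,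
    r20, r21, r22, r23, r24, r25, r26, r27, r28, r29, r30, r31, r32, r33, r34, r37, r38, r39,
    r40, r41, r42, r43, r44⟩ := H
  rw [i7, sub_self_range] at i8
  rw [i9, sub_self_range] at i10
  rw [i11, sub_self_range] at i12
  rw [r9, i8, map_getD_zero] at r10 r40
  rw [r9, i10, map_getD_zero] at r11 r41
  rw [r9, i12, map_getD_zero] at r12 r42
  rw [r4, i8, map_getD_zero] at r13
  rw [r4, i10, map_getD_zero] at r14
  rw [r4, i12, map_getD_zero] at r15
  rw [r7, i8, map_getD_zero] at r37
  rw [r7, i10, map_getD_zero] at r38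
  rw [r7, i12, map_getD_zero] at r39
  simp only [Rat.cast_zero, Rat.cast_one, Rat.cast_ofNat] at r4 r5 r6 r8 r9 r10 r11 r12 r13
  simp only [Rat.cast_zero, Rat.cast_one, Rat.cast_ofNat] at r14 r15 r37 r38 r39 r40 r41 r42
  replace r16 := rowSum_eq hlP r0 i0 r11 r16
  replace r17 := rowSum_eq hlC r1 i2 r12 r17
  rw [r4, i10, r16, combineByKey_singleton] at r18
  rw [r18, i12, r17, combineByKey_singleton] at r19
  obtain ⟨w, hw⟩ : ∃ w, w = List.foldl CombineOp.max.eval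
    (List.foldl CombineOp.max.eval 1 (List.ofFn fun i => ∑ j, P i j))
    (List.ofFn fun i => ∑ j, C i j) := ⟨_, rfl⟩
  have hwu : ∀ u, w ≤ u ↔ (1 ≤ u ∧ ∀ i, ∑ j, P i j ≤ u) ∧ ∀ i, ∑ j, C i j ≤ u := by
    intro u
    rw [hw, foldl_max_le, foldl_max_le]
    simp [List.mem_ofFn]
  rw [← hw] at r19
  obtain ⟨⟨h1, hwP⟩, hwC⟩ := (hwu w).1 le_rfl
  have hA : ∀ i, ∑ j, |constraintMatrix P C i j| ≤ w := by
    intro i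
    simp only [abs_constraintMatrix (fun i j => (hP i j).1) (fun i j => (hC i j).1)]
    cases i
    exacts [hwP _, hwC _]
  refine ⟨w, h1, (hwu _).2 ⟨⟨?_, fun i => ?_⟩, fun i => ?_⟩, hA, ?_⟩
  · exact_mod_cast one_le_width hN
  · exact (sum_row_le_rowWidth (fun i j => (hP i j).2) i).trans
      (by exact_mod_cast le_max_left _ _)
  · exact (sum_row_le_rowWidth (fun i j => (hC i j).2) i).trans
      (by exact_mod_cast le_max_right _ _)
  · have e22 : s'.real 22 = [(p : ℝ) + c] := by rw [r22, r20, r21, i5, i6]; rfl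
    have e27 : s'.real 27 = [rounds p c w ε] := by
      rw [r27, r26, r8, r25, r19, r24, r4, r23, e22, r2]; rfl
    have e30 : s'.real 30 = [2 * Real.log (1 + rounds p c w ε)] := by
      rw [r30, r5, r29, r28, r4, e27]; rfl
    have e31 : s'.real 31 = [12 * w] := by rw [r31, r6, r19]; rfl
    have e34 : s'.real 34 = [1 / ((p : ℝ) + c)] := by rw [r34, r4, e22]; rfl
    rw [e31, i10, map_getD_zero] at r32
    rw [e31, i12, map_getD_zero] at r33
    refine ⟨⟨i0, i1, i2, i3, i8, i10, i12, r0, r1, r2, r4, r5, r9, r10, r11, r12, r13, r14, r15,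
      e30, r32, r33, e34, r37, r38, r39⟩, _, _, ExtragradientInv.init _ _ (by linarith) ε,
      r40, r41, r42, ?_, ?_⟩
    · rw [r43, r9]
      simp [BinaryOp.eval]
    · rw [r44, e27, r9]
      simp [BinaryOp.eval]

/-! ### The final phase -/

/-- Compare with the unit vector of the violated row: that row alone already exceeds the regret
bound, so the subtracted term must be positive. -/
theorem sum_pos_of_violation {I J : Type*} [Fintype I] [Fintype J] {A : I → J → ℝ} {b : I → ℝ}
    {t : ℝ} {X : J → ℝ} {Y : I → ℝ}
    (h : ∀ x y, InDomain x y → regret A b t X Y x y ≤ ε * t) {i : I}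
    (hi : ε * t < ∑ j, A i j * X j - t * b i) {x : J → ℝ} (hx : ∀ j, 0 ≤ x j ∧ x j ≤ 1) :
    0 < ∑ i, Y i * (∑ j, A i j * x j - b i) := by
  classical
  have h1 := h x (Pi.single i 1)
    ⟨hx, fun k => by by_cases hk : k = i <;> simp [hk], by simp⟩
  simp only [regret, Pi.single_apply, ite_mul, one_mul, zero_mul, sum_ite_eq', mem_univ,
    if_true] at h1
  linarith

theorem sum_mul_violation (Y : Fin p ⊕ Fin c → ℝ) (x : Fin n → ℝ) :
    ∑ i, Y i * (∑ j, constraintMatrix P C i j * x j - rightHandSide p c i) =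
      (∑ i, Y (.inl i) * ((P.mulVec x) i - 1)) + ∑ i, Y (.inr i) * (1 - (C.mulVec x) i) := by
  rw [Fintype.sum_sum_type]
  congr 1
  refine sum_congr rfl fun i _ => ?_
  rw [sum_constraintMatrix_mul]
  simp only [rightHandSide, Sum.elim_inr, Matrix.mulVec, dotProduct]
  ring

theorem not_exists_isSolution {y : Fin p → ℝ} {z : Fin c → ℝ}
    (h : IsInfeasibilityCertificate P C y z) : ¬ ∃ x, IsSolution P C x := by
  rintro ⟨x, hx, hxP, hxC⟩
  have h1 := h.2.2 x hx
  have h2 : ∑ i, y i * ((P.mulVec x) i - 1) ≤ 0 := sum_nonpos fun i _ =>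
    mul_nonpos_of_nonneg_of_nonpos (h.1 i) (sub_nonpos.2 (hxP i))
  have h3 : ∑ i, z i * (1 - (C.mulVec x) i) ≤ 0 := sum_nonpos fun i _ =>
    mul_nonpos_of_nonneg_of_nonpos (h.2.1 i) (sub_nonpos.2 (hxC i))
  linarith

/-- The comparison of the largest violation of the average point with `ε` is sound in both
directions: a violation above `ε` turns the unnormalized sums `Y` into a certificate, which also
excludes solutions. -/
theorem correctOutput_of_sumsStored (hε : 0 < ε) (hw : 0 < w) (hm : 1 ≤ p + c)
    (hA : ∀ i, ∑ j, |constraintMatrix P C i j| ≤ w) (hlP : Lists P lP) (hlC : Lists C lC) {k : ℕ}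
    (hk : rounds p c w ε ≤ k) (h : SumsStored P C ε w lP lC k s)
    (hs' : s' = runAll (runAll s verdict) writeOutput) : CorrectOutput P C ε s' := by
  obtain ⟨hR, X, Y, hI, h40, h41, h42, h43, -⟩ := h
  have hkpos : (0 : ℝ) < k := (rounds_pos hw hε hm).trans_le hk
  have hregret : ∀ x y, InDomain x y →
      regret (constraintMatrix P C) (rightHandSide p c) k X Y x y ≤ ε * k := by
    intro x y hxy
    refine hI.regret_le hw.le hε hA ?_ hxy
    rw [Fintype.card_sum, Fintype.card_fin, Fintype.card_fin, Nat.cast_add, mul_assoc 576]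
    exact hk
  obtain ⟨s₁, e₁⟩ : ∃ s₁, s₁ = runAll s verdict := ⟨_, rfl⟩
  rw [← e₁] at hs'
  have K₁ : Keeps 100 s s₁ := e₁ ▸ runAll_keeps (by decide)
  have H₁ := holds_block (l := verdict) (by decide) s
  rw [← e₁] at H₁
  have hR₁ := hR.keeps (by norm_num) K₁
  rw [← K₁.1 _ (by norm_num)] at h40 h41 h42 h43
  have H₂ := holds_block (l := writeOutput) (by decide) s₁
  have f₂ : ∀ r ∈ [9, 10, 11, 12, 41, 42, 101, 113], s'.real r = s₁.real r := by
    intro r hr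
    rw [hs']
    refine runAll_real_of_ne ?_
    revert r
    decide
  rw [← hs'] at H₂
  simp only [verdict, List.Forall, Instr.Holds] at H₁
  simp only [writeOutput, List.Forall, Instr.Holds] at H₂
  obtain ⟨h100, h101, h102, h103, h104, h105, h106, h107, h108, h109, h110, h111, h112, h113⟩ := H₁
  obtain ⟨k0, k1, k2, k3⟩ := H₂
  rw [h43, hR₁.i8, map_getD_zero] at h100
  rw [h40, h100, zipWith_ofFn] at h101
  set x : Fin n → ℝ := fun j => BinaryOp.div.eval (X j) k
  have hXx : ∀ j, X j = k * x j := fun j => (mul_div_cancel₀ _ hkpos.ne').symm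
  have c104 := row_product hlP hR₁.r0 hR₁.i0 hR₁.i1 h101 hR₁.r11 h102 h103 h104
  have c109 := row_product hlC hR₁.r1 hR₁.i2 hR₁.i3 h101 hR₁.r12 h107 h108 h109
  rw [c104, hR₁.r14, zipWith_ofFn] at h105
  rw [hR₁.r9, hR₁.i10, h105, combineByKey_singleton] at h106
  rw [hR₁.r15, c109, zipWith_ofFn] at h110
  rw [h106, hR₁.i12, h110, combineByKey_singleton] at h111
  obtain ⟨v, hv⟩ : ∃ v, s₁.real 111 = [v] ∧ ∀ u, v ≤ u ↔
      (0 ≤ u ∧ ∀ i, (P.mulVec x) i - 1 ≤ u) ∧ ∀ i, 1 - (C.mulVec x) i ≤ u := by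
    refine ⟨_, h111, fun u => ?_⟩
    rw [foldl_max_le, foldl_max_le]
    simp [List.mem_ofFn, BinaryOp.eval, Matrix.mulVec, dotProduct]
  obtain ⟨h111, hv⟩ := hv
  rw [f₂ 113 (by decide), h113, h112, hR₁.r2, h111, hR₁.r4, f₂ 9 (by decide), hR₁.r9] at k0
  rw [f₂ 101 (by decide), h101, f₂ 10 (by decide), hR₁.r10, zipWith_ofFn] at k1
  rw [f₂ 41 (by decide), h41, f₂ 11 (by decide), hR₁.r11, zipWith_ofFn] at k2
  rw [f₂ 42 (by decide), h42, f₂ 12 (by decide), hR₁.r12, zipWith_ofFn] at k3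
  simp only [BinaryOp.eval, add_zero, List.zipWith_cons_cons, List.zipWith_nil_left]
    at k0 k1 k2 k3
  by_cases hvε : v ≤ ε
  · left
    rw [if_neg (not_lt.2 hvε), sub_zero] at k0
    obtain ⟨⟨-, hvP⟩, hvC⟩ := (hv ε).1 hvε
    refine ⟨k0, x, k1, fun j => ?_, fun i => ?_, fun i => ?_⟩
    · have h1 := hI.box j
      exact ⟨div_nonneg h1.1 hkpos.le, (div_le_one hkpos).2 h1.2⟩
    · linarith [hvP i]
    · linarith [hvC i]
  · right
    rw [if_pos (not_le.1 hvε), sub_self] at k0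
    have hcert : IsInfeasibilityCertificate P C (fun i => Y (.inl i)) (fun i => Y (.inr i)) := by
      obtain ⟨i, hi⟩ : ∃ i, ε * k <
          ∑ j, constraintMatrix P C i j * X j - k * rightHandSide p c i := by
        by_contra! hcon
        refine hvε ((hv ε).2 ⟨⟨hε.le, fun i => ?_⟩, fun i => ?_⟩)
        · have h1 := hcon (.inl i)
          rw [sum_constraintMatrix_mul] at h1
          simp only [Sum.elim_inl, rightHandSide, hXx, mul_left_comm _ (k : ℝ), ← mul_sum] at h1
          refine le_of_mul_le_mul_left (a := (k : ℝ)) ?_ hkpos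
          simp only [Matrix.mulVec, dotProduct]
          linarith
        · have h1 := hcon (.inr i)
          rw [sum_constraintMatrix_mul] at h1
          simp only [Sum.elim_inr, rightHandSide, hXx, mul_left_comm _ (k : ℝ), ← mul_sum] at h1
          refine le_of_mul_le_mul_left (a := (k : ℝ)) ?_ hkpos
          simp only [Matrix.mulVec, dotProduct]
          linarith
      refine ⟨fun i => hI.nonneg _, fun i => hI.nonneg _, fun x' hx' => ?_⟩
      rw [← sum_mul_violation]
      exact sum_pos_of_violation hregret hi hx'
    exact ⟨k0, not_exists_isSolution hcert, _, _, k2, k3, hcert⟩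

noncomputable def solverLength (p c : ℕ) (w ε : ℝ) : ℕ :=
  3 + (42 + ((⌈rounds p c w ε⌉₊ * (21 + 2 * replyLength p c w ε + 1) + 1) + (14 + 4)))

theorem attains_solver (hP : ∀ i j, 0 ≤ P i j ∧ P i j ≤ 1) (hC : ∀ i j, 0 ≤ C i j ∧ C i j ≤ 1)
    (hε : 0 < ε) (hN : 0 < nnz P + nnz C) (hn : n ≤ nnz P + nnz C) (hp : p ≤ nnz P + nnz C)
    (hc : c ≤ nnz P + nnz C) (hlP : Lists P lP) (hlC : Lists C lC) :
    ∃ w : ℝ, 1 ≤ w ∧ w ≤ width P C ∧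
      Attains (nnz P + nnz C) solver (input P C ε lP lC) (solverLength p c w ε)
        (CorrectOutput P C ε) := by
  have hm := one_le_add_of_nnz_pos hN
  obtain ⟨w, hw1, hww, hA, hS⟩ := runAll_setup (ε := ε) hP hC hlP hlC hN rfl
  have hw : 0 < w := by linarith
  refine ⟨w, hw1, hww, ?_⟩
  refine (attains_indexSetup (bounded_input hlP hlC hN le_rfl) hN hn hp hc).seq
    fun s₁ hs₁ e₁ => ?_
  refine (Attains.block hN hs₁ (l := setup) (by decide) (by decide)).seq fun s₂ hs₂ e₂ => ?_
  rw [← e₁, ← e₂] at hS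
  refine Attains.seq (Attains.loop (Inv := SumsStored P C ε w lP lC) ?_ ?_ hs₂ hS) ?_
  · rintro k s ⟨-, X, Y, -, -, -, -, -, h44⟩
    rw [h44]
    rfl
  · intro k s hs h
    exact attains_extragradientStep hN hs (fun i j => (hP i j).1) (fun i j => (hC i j).1) hε hw hm
      hA hlP hlC h
  · rintro s₃ hs₃ ⟨k, hk, h⟩
    refine (Attains.block hN hs₃ (l := verdict) (by decide) (by decide)).seq fun s₄ hs₄ e₄ =>
      (Attains.block hN hs₄ (l := writeOutput) (by decide) (by decide)).mono le_rfl
        fun s₅ e₅ => ?_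
    exact correctOutput_of_sumsStored hε hw hm hA hlP hlC hk h (e₄ ▸ e₅)

/-! ### The running time -/

theorem width_le : width P C ≤ n := by
  have h : ∀ {m : ℕ} (A : Matrix (Fin m) (Fin n) ℝ), rowWidth A ≤ n := fun A =>
    Finset.sup_le fun i _ => (Set.ncard_le_card _).trans_eq (by simp)
  exact max_le (h P) (h C)

/-- Up to rounding, the depth is the binary logarithm of `3N ≤ q²`. -/
theorem depthBound_le {N : ℕ} (hN : 1 ≤ N) {q : ℝ} (hq : 3 ≤ q) (hNq : N ≤ q)
    (hl : 1 ≤ Real.log q) : (depthBound N : ℝ) ≤ 5 * Real.log q := by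
  have h1 : 2 ^ (Nat.clog 2 (1 + 3 * N)).pred < 1 + 3 * N :=
    Nat.pow_pred_clog_lt_self (by norm_num) (by omega)
  have h2 : ((2 : ℝ) ^ (Nat.clog 2 (1 + 3 * N)).pred) ≤ q ^ 2 := by
    have : ((2 : ℝ) ^ (Nat.clog 2 (1 + 3 * N)).pred) ≤ 3 * N := by
      exact_mod_cast (by omega : 2 ^ (Nat.clog 2 (1 + 3 * N)).pred ≤ 3 * N)
    nlinarith
  have h3 := Real.log_le_log (by positivity) h2
  rw [Real.log_pow, Real.log_pow] at h3
  have h4 : ((Nat.clog 2 (1 + 3 * N) : ℕ) : ℝ) ≤ (Nat.clog 2 (1 + 3 * N)).pred + 1 := by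
    exact_mod_cast (by simp only [Nat.pred_eq_sub_one]; omega)
  have h5 := Real.log_two_gt_d9
  have h6 : (0 : ℝ) ≤ ((Nat.clog 2 (1 + 3 * N)).pred : ℝ) := Nat.cast_nonneg _
  rw [depthBound, Nat.cast_add, Nat.cast_one]
  push_cast at h3
  nlinarith

/-- At most `1729 (ω/ε) ℓ` outer rounds of at most `1288 ℓ` steps each, plus `64` steps outside the
rounds: `1729 · 1288 + 64 = 2227016`. -/
theorem solverLength_le (hε : 0 < ε) (hε1 : ε ≤ 1) {N : ℕ} {ω : ℝ} (hw : 1 ≤ w) (hwω : w ≤ ω)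
    (hωN : ω ≤ N) (hm : 1 ≤ p + c) (hp : p ≤ N) (hc : c ≤ N) (hl : 1 ≤ Real.log (2 + N / ε)) :
    (solverLength p c w ε : ℝ) ≤ 2227016 * (ω / ε) * Real.log (2 + N / ε) ^ 2 := by
  set q := 2 + N / ε
  set ℓ := Real.log q
  have hN1 : (1 : ℝ) ≤ N := by linarith
  have hNε : (N : ℝ) ≤ N / ε := le_div_self (by linarith) hε hε1
  have hq : 3 ≤ q := by simp only [q]; linarith
  have hωε : 1 ≤ ω / ε := (one_le_div hε).2 (by linarith)
  have hωq : ω / ε ≤ q := by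
    have : ω / ε ≤ N / ε := by gcongr
    simp only [q]
    linarith
  have hm' : (1 : ℝ) ≤ p + c := by exact_mod_cast hm
  have hlog : 1 + Real.log (p + c) ≤ 3 * ℓ := by
    have h1 : (p : ℝ) + c ≤ q ^ 2 := by
      have : (p : ℝ) ≤ N := by exact_mod_cast hp
      have : (c : ℝ) ≤ N := by exact_mod_cast hc
      have : (p : ℝ) + c ≤ 2 * q := by simp only [q]; linarith
      nlinarith
    have h2 := Real.log_le_log (by linarith) h1
    rw [Real.log_pow] at h2
    push_cast at h2
    linarith
  have hlog0 := Real.log_nonneg hm'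
  have hR : rounds p c w ε ≤ 1728 * (ω / ε) * ℓ := by
    have : w * (1 + Real.log (p + c)) ≤ ω * (3 * ℓ) :=
      mul_le_mul hwω hlog (by linarith) (by linarith)
    calc rounds p c w ε ≤ 576 * (ω * (3 * ℓ)) / ε := by unfold rounds; gcongr
      _ = _ := by ring
  have hR0 : 0 < rounds p c w ε := rounds_pos (by linarith) hε hm
  have hinner : 2 * Real.log (1 + rounds p c w ε) ≤ 18 * ℓ := by
    have h1 : ℓ ≤ q := (Real.log_le_sub_one_of_pos (by linarith)).trans (by linarith)
    -- A polynomial bound in `q` makes the number of inner rounds linear in `ℓ`; here `1 + 1728 q² ≤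
    -- 3 ^ 7 q²` and `3 ≤ q`.
    have h2 : 1 + rounds p c w ε ≤ q ^ 9 := by
      have h3 : ω / ε * ℓ ≤ q * q := mul_le_mul hωq h1 (by linarith) (by linarith)
      have h4 : (3 : ℝ) ^ 7 ≤ q ^ 7 := by gcongr
      calc 1 + rounds p c w ε ≤ 3 ^ 7 * q ^ 2 := by nlinarith
        _ ≤ q ^ 7 * q ^ 2 := by gcongr
        _ = q ^ 9 := by ring
    have h5 := Real.log_le_log (by linarith) h2
    rw [Real.log_pow] at h5
    push_cast at h5
    linarith
  have hc1 : (⌈2 * Real.log (1 + rounds p c w ε)⌉₊ : ℝ) ≤ 19 * ℓ := by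
    have := (Nat.ceil_lt_add_one
      (mul_nonneg zero_le_two (Real.log_nonneg (by linarith [hR0.le])))).le.trans
        (add_le_add_left hinner 1)
    linarith
  have hωℓ : 1 ≤ ω / ε * ℓ := one_le_mul_of_one_le_of_one_le hωε hl
  have hc2 : (⌈rounds p c w ε⌉₊ : ℝ) ≤ 1729 * (ω / ε * ℓ) := by
    have := (Nat.ceil_lt_add_one hR0.le).le
    linarith
  have hstep : (21 + 2 * (24 + ((⌈2 * Real.log (1 + rounds p c w ε)⌉₊ : ℝ) * 32 + 1)) + 1) ≤
      1288 * ℓ := by linarith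
  have hprod := mul_le_mul hc2 hstep (by positivity) (by positivity)
  have hωℓ2 : 1 ≤ ω / ε * ℓ ^ 2 := one_le_mul_of_one_le_of_one_le hωε (one_le_pow₀ hl)
  rw [solverLength, replyLength]
  push_cast
  nlinarith

end Correctness

end MPC

theorem theorem1 :
    ∃ (A : MPC.Prog) (K : ℝ) (k : ℕ),
      ∀ (n p c : ℕ) (P : Matrix (Fin p) (Fin n) ℝ) (C : Matrix (Fin c) (Fin n) ℝ) (ε : ℝ) (N : ℕ)
        (lP : List (Fin p × Fin n)) (lC : List (Fin c × Fin n)),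
        (∀ i j, 0 ≤ P i j ∧ P i j ≤ 1) →
        (∀ i j, 0 ≤ C i j ∧ C i j ≤ 1) →
        0 < ε → ε ≤ 1 →
        N = MPC.nnz P + MPC.nnz C →
        0 < N → n ≤ N → p ≤ N → c ≤ N →
        MPC.Lists P lP → MPC.Lists C lC →
        ∃ (s : MPC.State) (T W : ℕ),
          MPC.Exec A (MPC.input P C ε lP lC) s T W ∧
          MPC.CorrectOutput P C ε s ∧
          (T : ℝ) ≤ K * ((MPC.width P C : ℝ) / ε) * Real.log (2 + N / ε) ^ k ∧
          (W : ℝ) ≤ K * ((MPC.width P C : ℝ) * N / ε) * Real.log (2 + N / ε) ^ k := by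
  -- The step count gives `2227016` and two logarithms, the depth per step gives `5` and the third
  -- one, and `4` comes from `1 + 3N ≤ 4N` in the work.
  refine ⟨MPC.solver, 4 * (5 * 2227016), 3, ?_⟩
  rintro n p c P C ε N lP lC hP hC hε hε1 rfl hN hn hp hc hlP hlC
  obtain ⟨w, hw, hww, s, T, W, hE, -, hT, hW, hQ⟩ :=
    MPC.attains_solver hP hC hε hN hn hp hc hlP hlC
  refine ⟨s, T, W, hE, hQ, ?_⟩
  set N := MPC.nnz P + MPC.nnz C
  set q : ℝ := 2 + (N : ℝ) / ε
  have hN1 : (1 : ℝ) ≤ N := by exact_mod_cast hN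
  have hNε : (N : ℝ) ≤ N / ε := le_div_self (by linarith) hε hε1
  have hq : 3 ≤ q := by simp only [q]; linarith
  have hl : 1 ≤ Real.log q := by
    rw [Real.le_log_iff_exp_le (by linarith)]
    linarith [Real.exp_one_lt_d9]
  have hωN : (MPC.width P C : ℝ) ≤ N := by exact_mod_cast (MPC.width_le (P := P) (C := C)).trans hn
  have hS := MPC.solverLength_le hε hε1 hw hww hωN (MPC.one_le_add_of_nnz_pos hN) hp hc hl
  have hD := MPC.depthBound_le hN hq (by simp only [q]; linarith) hl
  have hSD := mul_le_mul hS hD (by positivity) (by positivity)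
  have hT' : (T : ℝ) ≤ MPC.solverLength p c w ε * MPC.depthBound N := by exact_mod_cast hT
  have hW' : (W : ℝ) ≤ MPC.solverLength p c w ε * ((1 + 3 * N) * MPC.depthBound N) := by
    exact_mod_cast hW
  have hpos : 0 ≤ (MPC.width P C : ℝ) / ε * Real.log q ^ 3 := by positivity
  constructor
  · refine hT'.trans (hSD.trans ?_)
    linarith
  · calc (W : ℝ) ≤ (1 + 3 * N) * (MPC.solverLength p c w ε * MPC.depthBound N) := by
          linarith
      _ ≤ (4 * N) * (2227016 * (MPC.width P C / ε) * Real.log q ^ 2 * (5 * Real.log q)) :=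
          mul_le_mul (by linarith) hSD (by positivity) (by positivity)
      _ = _ := by ring
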